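/- Let $\mathbb{R}_{\max}=\mathbb{R}\cup\{\varepsilon\}$, $\varepsilon=-\infty$, be the max-plus semiring with $a\oplus b=\max\{a,b\}$ and $a\otimes b=a+b$, with the topology of $[-\infty,\infty)$. Let $\mathcal E$ be the vector with all entries $\varepsilon$. Let $A=(a_{ij})\in\mathbb{R}_{\max}^{n\times n}$. **Eigenvalues, circuits.** The graph $G(A)$ has vertices $1,\dots,n$ and an edge $(i,j)$ of weight $a_{ij}$ whenever $a_{ij}\ne\varepsilon$. A multi-circuit $\mathcal C$ is a (possibly empty) union of vertex-disjoint elementary circuits (loops allowed); $V(\mathcal C)$, $E(\mathcal C)$, $\ell(\mathcal C)$, $w(\mathcal C)$ denote its vertex set, edge set, number of edges and total weight. Let $\chi_A(t)=\bigoplus_{\pi\in S_n}\bigotimes_{i}[A\oplus t\otimes E_n]_{i\pi(i)}$, where $E_n$ is the max-plus unit matrix. The set $\Lambda\subset\mathbb{R}_{\max}$ of algebraic eigenvalues of $A$ consists of the roots of $\chi_A$, i.e. of the $r_k$ in the factorization $\chi_A(t)=\bigotimes_{k=1}^n(t\oplus r_k)$ as functions on $\mathbb{R}_{\max}$. For $\lambda\in\mathbb{R}$,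 a multi-circuit $\mathcal C$ in $G(A)$ is $\lambda$-maximal if $\chi_A(\lambda)=w(\mathcal C)\otimes\lambda^{\otimes(n-\ell(\mathcal C))}$; it is $\varepsilon$-maximal if it is $\mu$-maximal for all sufficiently small real $\mu$. An elementary circuit of $G(P)$ is critical if its average weight (weight divided by length) is the maximum eigenvalue of $P$, where $\mu$ is an eigenvalue of $P$ if $P\otimes x=\mu\otimes x$ for some $x\neq\mathcal E$. **Matrices attached to a multi-circuit.** Let $A_{\mathcal C}$ (resp. $A_{\setminus\mathcal C}$) be obtained from $A$ by replacing the entries outside (resp. in) $E(\mathcal C)$ by $\varepsilon$, and let $E_{\mathcal C}$ (resp. $E_{\setminus\mathcal C}$) be obtained from $E_n$ by keeping only the diagonal entries with index in (resp. outside) $V(\mathcal C)$ and replacing the others by $\varepsilon$. Put $$W(A,\lambda,\mathcal C)=\{x\in\mathbb{R}_{\max}^n : (A_{\setminus\mathcal C}\oplus\lambda\otimes E_{\mathcal C})\otimes x=(A_{\mathcal C}\oplus\lambda\otimes E_{\setminus\mathcal C})\otimes x\},$$ $$B_{A,\lambda,\mathcal C}=(A_{\mathcal C}\oplus\lambda\otimes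 E_{\setminus\mathcal C})^{-1}\otimes(A_{\setminus\mathcal C}\oplus\lambda\otimes E_{\mathcal C}).$$ **Algebraic eigenspaces.** For $\zeta\in[0,1]^{n\times n}$ and $\delta>0$ let $[A(\zeta;\delta)]_{ij}=a_{ij}-\zeta_{ij}\delta$. Let $Z$ be the set of $\zeta\in[0,1]^{n\times n}$ such that, for all sufficiently small $\delta>0$ and all $\lambda\in\mathbb{R}_{\max}$, distinct $\lambda$-maximal multi-circuits of $G(A(\zeta;\delta))$ have different lengths. For $\lambda\in\mathbb{R}_{\max}$ define $$W(A,\lambda)=\bigcap_{\zeta\in Z}\ \lim_{\delta\to+0}\ \bigoplus_{\lambda'}W(A(\zeta;\delta),\lambda',\mathcal C_{\lambda'}),$$ where $\lambda'$ runs over $[\lambda-n\delta,\lambda+n\delta]$ (over $\{\varepsilon\}$ if $\lambda=\varepsilon$), $\mathcal C_{\lambda'}$ is a $\lambda'$-maximal multi-circuit of $G(A(\zeta;\delta))$ (for small $\delta$ the space does not depend on its choice), $\bigoplus$ is the max-plus sum of subspaces, and $\lim_{\delta\to+0}S(\delta)$ is the set of all limits of families $x(\delta)\in S(\delta)$. A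 basis of a max-plus subspace is a minimal spanning set. **Theorem.** For each $\lambda\in\Lambda$ let $\mathcal B_\lambda$ be a basis of the algebraic eigenspace $W(A,\lambda)$. Suppose that for every real $\lambda\in\Lambda$ and every $\lambda$-maximal multi-circuit $\mathcal C$ of $G(A)$, any two distinct critical (elementary) circuits of $G(B_{A,\lambda,\mathcal C})$ have no common vertex. Then $\bigcup_{\lambda\in\Lambda}\mathcal B_\lambda$ is a basis of the max-plus sum $\bigoplus_{\lambda\in\Lambda}W(A,\lambda)$. In particular, no vector in $\bigcup_{\lambda\in\Lambda}\mathcal B_\lambda$ is a max-plus linear combination of the others. -/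

import Mathlib

open Filter Topology

noncomputable section

/-! ### The max-plus semiring -/

/-- The max-plus algebra `ℝ ∪ {-∞}`.  As a semiring, `a + b` is the maximum of `a` and `b`, and
`a * b` is the ordinary sum; so `0 : RMax` is `ε = -∞` and `1 : RMax` is the real number `0`. -/
def RMax : Type := WithBot ℝ

namespace RMax

instance : LinearOrder RMax := inferInstanceAs (LinearOrder (WithBot ℝ))

/-- The topology of `[-∞, ∞)`. -/
instance : TopologicalSpace RMax := Preorder.topology RMax

instance : OrderTopology RMax := ⟨rfl⟩

instance : DenselyOrdered RMax := inferInstanceAs (DenselyOrdered (WithBot ℝ))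

/-- The inclusion of the reals. -/
def ofReal (r : ℝ) : RMax := (WithBot.some r : WithBot ℝ)

/-- The real number underlying a finite element (and `0` for `ε`). -/
def toReal (a : RMax) : ℝ := WithBot.unbotD 0 (show WithBot ℝ from a)

instance : Add RMax := ⟨fun a b => max a b⟩

instance : Zero RMax := ⟨(⊥ : WithBot ℝ)⟩

instance : Mul RMax :=
  ⟨fun a b => ((show WithBot ℝ from a) + (show WithBot ℝ from b) : WithBot ℝ)⟩

instance : One RMax := ⟨ofReal 0⟩

instance : CommSemiring RMax where
  nsmul := nsmulRec
  add_assoc a b c := max_assoc a b c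
  zero_add a := max_eq_right (bot_le (a := (show WithBot ℝ from a)))
  add_zero a := max_eq_left (bot_le (a := (show WithBot ℝ from a)))
  add_comm a b := max_comm a b
  left_distrib a b c := (max_add_add_left (show WithBot ℝ from a) b c).symm
  right_distrib a b c := (max_add_add_right (show WithBot ℝ from a) b c).symm
  zero_mul a := WithBot.bot_add (show WithBot ℝ from a)
  mul_zero a := WithBot.add_bot (show WithBot ℝ from a)
  mul_assoc a b c := add_assoc (show WithBot ℝ from a) b c
  one_mul a := zero_add (show WithBot ℝ from a)
  mul_one a := add_zero (show WithBot ℝ from a)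
  mul_comm a b := add_comm (show WithBot ℝ from a) b

theorem add_eq_max (a b : RMax) : a + b = max a b := rfl

theorem mul_eq_add (a b : RMax) :
    a * b = ((show WithBot ℝ from a) + (show WithBot ℝ from b) : WithBot ℝ) := rfl

theorem zero_eq_bot : (0 : RMax) = (⊥ : WithBot ℝ) := rfl

theorem one_eq_ofReal : (1 : RMax) = ofReal 0 := rfl

theorem ofReal_mul (a b : ℝ) : ofReal a * ofReal b = ofReal (a + b) := rfl

theorem eq_zero_or_ofReal (a : RMax) : a = 0 ∨ ∃ r, a = ofReal r :=
  match (show WithBot ℝ from a) with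
  | none => Or.inl rfl
  | some r => Or.inr ⟨r, rfl⟩

theorem mul_le_mul_left_of_le (c : RMax) {a b : RMax} (h : a ≤ b) : c * a ≤ c * b := by
  have h1 : c * a + c * b = c * b := by
    rw [← mul_add, add_eq_max, max_eq_right h]
  rw [← h1, add_eq_max]
  exact le_max_left _ _

theorem continuous_const_mul (c : RMax) : Continuous (fun a : RMax => c * a) := by
  rcases eq_zero_or_ofReal c with rfl | ⟨r, rfl⟩
  · simpa using (continuous_const : Continuous fun _ : RMax => (0 : RMax))
  · have key : ∀ (s t : ℝ), s + t = 0 → ∀ a, ofReal s * (ofReal t * a) = a := by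
      intro s t hst a
      rw [← mul_assoc, ofReal_mul, hst, ← one_eq_ofReal, one_mul]
    have hm : Monotone (fun a : RMax => ofReal r * a) :=
      fun a b h => mul_le_mul_left_of_le _ h
    exact hm.continuous_of_surjective fun a => ⟨ofReal (-r) * a, key r (-r) (by ring) a⟩

end RMax

/-- Max-plus `n × n` matrices. Matrix operations are those over the semiring `RMax`. -/
abbrev MPMatrix (n : ℕ) : Type := Matrix (Fin n) (Fin n) RMax

/-- Max-plus column vectors. -/
abbrev MPVec (n : ℕ) : Type := Fin n → RMax

/-- `B` is a basis, that is, a minimal spanning set, of the max-plus subspace `U`. -/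
def IsMPBasis {n : ℕ} (B : Set (MPVec n)) (U : Submodule RMax (MPVec n)) : Prop :=
  Minimal (fun S : Set (MPVec n) => Submodule.span RMax S = U) B

/-! ### Eigenvalues, determinant, characteristic polynomial -/

/-- `mu` is an eigenvalue of `A`. -/
def IsMPEigenvalue {n : ℕ} (A : MPMatrix n) (mu : RMax) : Prop :=
  ∃ x : MPVec n, x ≠ 0 ∧ A.mulVec x = mu • x

/-- The max-plus determinant: the maximum over all permutations of the weights. -/
def mpDet {n : ℕ} (A : MPMatrix n) : RMax :=
  ∑ p : Equiv.Perm (Fin n), ∏ i, A i (p i)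

/-- The max-plus characteristic polynomial, as a function on `RMax`. -/
def mpCharpoly {n : ℕ} (A : MPMatrix n) (t : RMax) : RMax :=
  mpDet (A + t • (1 : MPMatrix n))

/-- The algebraic eigenvalues of `A`, that is, the roots of its (monic) characteristic polynomial:
the elements `r` of the multiset `s` in the factorization of `mpCharpoly A` into linear factors
`t ⊕ r`. -/
def algEigenvalues {n : ℕ} (A : MPMatrix n) : Set RMax :=
  {mu | ∃ s : Multiset RMax,
    (∀ t : RMax, mpCharpoly A t = (s.map fun r => t + r).prod) ∧ mu ∈ s}

/-! ### Circuits -/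

/-- A multi-circuit on the vertices `Fin n`, that is, a union of vertex-disjoint elementary circuits
(loops and the empty union are allowed). It is given by its vertex set and by the map sending each of
its vertices to the succeeding one, extended by the identity to a permutation of all vertices;
the circuits in it are the orbits of this map on the vertex set. -/
@[ext]
structure MultiCircuit (n : ℕ) where
  verts : Finset (Fin n)
  next : Equiv.Perm (Fin n)
  next_eq : ∀ i, i ∉ verts → next i = i

namespace MultiCircuit

variable {n : ℕ}

/-- The edge set. -/
def edges (C : MultiCircuit n) : Set (Fin n × Fin n) :=
  {e | e.1 ∈ C.verts ∧ e.2 = C.next e.1}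

/-- The length. -/
def length (C : MultiCircuit n) : ℕ := C.verts.card

/-- The weight: the (ordinary) sum of the weights of all edges. -/
def weight (A : MPMatrix n) (C : MultiCircuit n) : RMax := ∏ i ∈ C.verts, A i (C.next i)

/-- `C` is a multi-circuit in the graph `G(A)`, whose edges are the pairs `(i, j)` with
`A i j ≠ ε`. -/
def InGraph (A : MPMatrix n) (C : MultiCircuit n) : Prop :=
  ∀ e ∈ C.edges, A e.1 e.2 ≠ 0

/-- `C` is a single elementary circuit: its vertices form one cycle. -/
def IsElementary (C : MultiCircuit n) : Prop :=
  C.verts.Nonempty ∧ C.next.IsCycleOn (C.verts : Set (Fin n))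

/-- The average weight, for a circuit in `G(A)`. -/
def avgWeight (A : MPMatrix n) (C : MultiCircuit n) : ℝ :=
  (C.weight A).toReal / C.length

/-- `C` is an elementary critical circuit in `G(A)`: its average weight is the maximum eigenvalue
of `A`. -/
def IsCritical (A : MPMatrix n) (C : MultiCircuit n) : Prop :=
  C.IsElementary ∧ C.InGraph A ∧
    IsGreatest {mu | IsMPEigenvalue A mu} (RMax.ofReal (C.avgWeight A))

/-- `C` is `lam`-maximal, for a real number `lam`: the term of the multi-circuit `C` attains the
maximum in the characteristic polynomial at `lam`. -/
def IsMaximalReal (A : MPMatrix n) (lam : ℝ) (C : MultiCircuit n) : Prop :=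
  C.InGraph A ∧
    mpCharpoly A (RMax.ofReal lam) = C.weight A * RMax.ofReal lam ^ (n - C.length)

/-- `C` is `lam`-maximal, for `lam` in `RMax`; to be `ε`-maximal is to be `mu`-maximal for all
sufficiently small real `mu`. -/
def IsMaximal (A : MPMatrix n) (lam : RMax) (C : MultiCircuit n) : Prop :=
  (∀ r : ℝ, lam = RMax.ofReal r → C.IsMaximalReal A r) ∧
    (lam = 0 → ∀ᶠ mu : ℝ in atBot, C.IsMaximalReal A mu)

end MultiCircuit

section Split

open scoped Classical

variable {n : ℕ}

/-- The matrix `A_C`: the entries of `A` on the edges of `C`. -/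
def matOn (A : MPMatrix n) (C : MultiCircuit n) : MPMatrix n :=
  Matrix.of fun i j => if (i, j) ∈ C.edges then A i j else 0

/-- The matrix `A_{\C}`: the entries of `A` off the edges of `C`. -/
def matOff (A : MPMatrix n) (C : MultiCircuit n) : MPMatrix n :=
  Matrix.of fun i j => if (i, j) ∈ C.edges then 0 else A i j

/-- The matrix `E_C`: the unit matrix on the vertices of `C`. -/
def unitOn (C : MultiCircuit n) : MPMatrix n :=
  Matrix.of fun i j => if i = j ∧ i ∈ C.verts then 1 else 0

/-- The matrix `E_{\C}`: the unit matrix off the vertices of `C`. -/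
def unitOff (C : MultiCircuit n) : MPMatrix n :=
  Matrix.of fun i j => if i = j ∧ i ∉ C.verts then 1 else 0

end Split

/-- The matrix `B_{A,lam,C} = (A_C ⊕ lam ⊗ E_{\C})⁻¹ ⊗ (A_{\C} ⊕ lam ⊗ E_C)`. The inverse is the
inverse in the semiring of max-plus matrices; it exists for real `lam` and `C` in `G(A)`. -/
def matB {n : ℕ} (A : MPMatrix n) (lam : RMax) (C : MultiCircuit n) : MPMatrix n :=
  Ring.inverse (matOn A C + lam • unitOff C) * (matOff A C + lam • unitOn C)

/-! ### Algebraic eigenspaces -/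

/-- The subspace `W(A, lam, C)` of all `x` with
`(A_{\C} ⊕ lam ⊗ E_C) ⊗ x = (A_C ⊕ lam ⊗ E_{\C}) ⊗ x`. -/
def circuitEigenspace {n : ℕ} (A : MPMatrix n) (lam : RMax) (C : MultiCircuit n) :
    Submodule RMax (MPVec n) where
  carrier := {x | (matOff A C + lam • unitOn C).mulVec x = (matOn A C + lam • unitOff C).mulVec x}
  add_mem' := by
    intro x y hx hy
    change _ = _ at hx hy ⊢
    rw [Matrix.mulVec_add, Matrix.mulVec_add, hx, hy]
  zero_mem' := by
    change _ = _
    rw [Matrix.mulVec_zero, Matrix.mulVec_zero]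
  smul_mem' := by
    intro c x hx
    change _ = _ at hx ⊢
    rw [Matrix.mulVec_smul, Matrix.mulVec_smul, hx]

/-- Genericity of a matrix: for every `lam` in `RMax`, any two distinct `lam`-maximal multi-circuits
have different lengths. -/
def DistinctLengths {n : ℕ} (A : MPMatrix n) : Prop :=
  ∀ (lam : RMax) (C C' : MultiCircuit n), C.IsMaximal A lam → C'.IsMaximal A lam → C ≠ C' →
    C.length ≠ C'.length

/-- The perturbed matrix with entries `a_ij - zeta_ij * delta`. -/
def perturb {n : ℕ} (A : MPMatrix n) (zeta : Matrix (Fin n) (Fin n) ℝ) (delta : ℝ) : MPMatrix n :=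
  Matrix.of fun i j => A i j * RMax.ofReal (-(zeta i j * delta))

/-- The set `Z` of perturbation directions `zeta` in `[0,1]^{n × n}` such that the perturbed matrix is
generic for all sufficiently small `delta > 0`. -/
def genericDirections {n : ℕ} (A : MPMatrix n) : Set (Matrix (Fin n) (Fin n) ℝ) :=
  {zeta | (∀ i j, zeta i j ∈ Set.Icc (0 : ℝ) 1) ∧
    ∃ delta' > 0, ∀ delta, 0 < delta → delta < delta' → DistinctLengths (perturb A zeta delta)}

/-- The closed ball of radius `rho` about `lam`, which is `{ε}` if `lam = ε`. -/
def rmaxBall (lam : RMax) (rho : ℝ) : Set RMax :=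
  {mu | (lam = 0 ∧ mu = 0) ∨
    ∃ r s : ℝ, lam = RMax.ofReal r ∧ mu = RMax.ofReal s ∧ s ∈ Set.Icc (r - rho) (r + rho)}

/-- The limit, as `delta` tends to `0` from above, of a family of subspaces: all limits of families
`x(delta) ∈ S(delta)`. -/
def limSubspace {n : ℕ} (S : ℝ → Submodule RMax (MPVec n)) : Submodule RMax (MPVec n) where
  carrier := {x | ∃ y : ℝ → MPVec n, (∀ delta > 0, y delta ∈ S delta) ∧
    Tendsto y (𝓝[>] (0 : ℝ)) (𝓝 x)}
  add_mem' := by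
    rintro a b ⟨y, hy, hya⟩ ⟨z, hz, hzb⟩
    refine ⟨fun d => y d + z d, fun d hd => (S d).add_mem (hy d hd) (hz d hd), ?_⟩
    rw [tendsto_pi_nhds] at hya hzb ⊢
    intro i
    exact (hya i).max (hzb i)
  zero_mem' := ⟨fun _ => 0, fun d _ => (S d).zero_mem, tendsto_const_nhds⟩
  smul_mem' := by
    rintro c a ⟨y, hy, hya⟩
    refine ⟨fun d => c • y d, fun d hd => (S d).smul_mem c (hy d hd), ?_⟩
    rw [tendsto_pi_nhds] at hya ⊢
    intro i
    exact ((RMax.continuous_const_mul c).tendsto (a i)).comp (hya i)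

/-- The max-plus sum, over all `lam'` in the ball of radius `n * delta` about `lam`, of the subspaces
`W(A(zeta; delta), lam', C')` with `C'` a `lam'`-maximal multi-circuit of the perturbed matrix.
Where the perturbed matrix is generic, `W(A(zeta; delta), lam', C')` is the same for all
`lam'`-maximal `C'`, so that summing over all of them amounts to choosing one. -/
def perturbedSum {n : ℕ} (A : MPMatrix n) (lam : RMax) (zeta : Matrix (Fin n) (Fin n) ℝ)
    (delta : ℝ) : Submodule RMax (MPVec n) :=
  ⨆ lam' ∈ rmaxBall lam (n * delta),
    ⨆ (C' : MultiCircuit n) (_ : C'.IsMaximal (perturb A zeta delta) lam'),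
      circuitEigenspace (perturb A zeta delta) lam' C'

/-- The algebraic eigenspace `W(A, lam)`. -/
def algEigenspace {n : ℕ} (A : MPMatrix n) (lam : RMax) : Submodule RMax (MPVec n) :=
  ⨅ zeta ∈ genericDirections A, limSubspace (perturbedSum A lam zeta)

end

/-! Suppose a basis vector x at `lam` is a combination of the other vectors. Then x = z ⊕ y, with z
in the span of the other basis vectors at `lam` and y in the sum of the other eigenspaces. So every
finite coordinate of x is attained either by z or by a vector below x from some W(A, mu) with mu ≠
lam. By `eq_of_cover` this forces z = x, which contradicts the minimality of the basis at `lam`. One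
generic direction zeta is enough for that lemma.

Row i of A ⊕ lam ⊗ E offers n + 1 terms: the entries of A, and separately `lam` in column i. A
multi-circuit selects one term per row, in distinct columns, and is maximal when the total weight
is. A vector lies in W(A, lam, C) exactly when in each row the term of C attains the maximum and so
does some second term. In the limit, an ultrafilter fixes one C and one choice T of second terms,
serving both the limit vector and almost all perturbed matrices. Following T from a column where z <
x, the deficit of z persists until a cycle closes. Exchanging the terms of C for those of T along
the cycle gives another maximal multi-circuit of the perturbed matrix. If its length is that of C,
genericity is violated.

For real `lam` the length is controlled as follows. Inside a minimal closed set of columns the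
saturated terms form a strongly connected graph, whose cycles are critical circuits of B.
Disjointness therefore leaves exactly two saturated terms in each row of the cycle
(`eq_of_saturated`). Mark a column if it is attained by a vector for some mu < lam. Two entries of A
saturated in one row have columns with equal marks, whereas beside the term `lam` the marks differ,
column i being the marked one. Summing round the cycle, C and T use `lam` equally often
(`length_switch_eq`).

For lam = ε no disjointness is needed: a cycle within the rows of C preserves the length at once,
and a path leaving them ends at a coordinate that no other eigenspace can attain
(`eq_of_cover_zero`). -/

/-! ### Order, algebra and topology of the max-plus semiring -/

namespace RMax

theorem mul_lt_mul_left_of_pos {c a b : RMax} (hc : 0 < c) (h : a < b) : c * a < c * b := by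
  refine lt_of_le_of_ne (mul_le_mul_left_of_le c h.le) fun he => h.ne ?_
  obtain rfl | ⟨r, rfl⟩ := eq_zero_or_ofReal c
  · exact absurd hc (lt_irrefl _)
  · have := congrArg (ofReal (-r) * ·) he
    simpa only [← mul_assoc, ofReal_mul, neg_add_cancel, ← one_eq_ofReal, one_mul] using this

noncomputable instance : LinearOrderedCommGroupWithZero RMax where
  __ := (inferInstance : CommSemiring RMax)
  __ := (inferInstance : LinearOrder RMax)
  bot := 0
  bot_le a := bot_le (a := (show WithBot ℝ from a))
  isBot_zero a := bot_le (a := (show WithBot ℝ from a))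
  mul_lt_mul_of_pos_left := fun c hc _ _ h => mul_lt_mul_left_of_pos hc h
  inv a := if a = 0 then 0 else ofReal (-a.toReal)
  exists_pair_ne := ⟨0, 1, fun h => WithBot.bot_ne_coe h⟩
  inv_zero := if_pos rfl
  mul_inv_cancel a ha := by
    obtain rfl | ⟨r, rfl⟩ := eq_zero_or_ofReal a
    · exact absurd rfl ha
    · change ofReal r * (if ofReal r = 0 then 0 else ofReal (-(ofReal r).toReal)) = 1
      rw [if_neg ha]
      change ofReal r * ofReal (-r) = 1
      rw [ofReal_mul, add_neg_cancel, one_eq_ofReal]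

instance : MulLeftMono RMax := ⟨fun c _ _ h => mul_le_mul_left_of_le c h⟩

instance : IsOrderedMonoid RMax where
  mul_le_mul_left a b h c := by
    rw [mul_comm a, mul_comm b]; exact mul_le_mul_left_of_le c h

theorem le_add_iff {a b c : RMax} : a ≤ b + c ↔ a ≤ b ∨ a ≤ c := le_max_iff

theorem add_le_iff {a b c : RMax} : b + c ≤ a ↔ b ≤ a ∧ c ≤ a := max_le_iff

theorem sum_le_iff {ι : Type*} {s : Finset ι} {f : ι → RMax} {a : RMax} :
    ∑ i ∈ s, f i ≤ a ↔ ∀ i ∈ s, f i ≤ a := by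
  classical
  induction s using Finset.induction_on with
  | empty => simp
  | insert i s hi ih => rw [Finset.sum_insert hi, add_le_iff, ih, Finset.forall_mem_insert]

theorem le_sum {ι : Type*} {s : Finset ι} {f : ι → RMax} {i : ι} (hi : i ∈ s) :
    f i ≤ ∑ j ∈ s, f j :=
  sum_le_iff.1 le_rfl i hi

theorem exists_mem_sum_eq {ι : Type*} {s : Finset ι} (hs : s.Nonempty) (f : ι → RMax) :
    ∃ i ∈ s, ∑ j ∈ s, f j = f i := by
  obtain ⟨i, hi, h⟩ := s.exists_max_image f hs
  exact ⟨i, hi, le_antisymm (sum_le_iff.2 h) (le_sum hi)⟩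

@[simp] theorem ofReal_ne_zero (r : ℝ) : ofReal r ≠ 0 := WithBot.coe_ne_bot

theorem ofReal_injective : Function.Injective ofReal := WithBot.coe_injective

@[simp] theorem ofReal_inj {r s : ℝ} : ofReal r = ofReal s ↔ r = s := ofReal_injective.eq_iff

theorem ofReal_le {r s : ℝ} : ofReal r ≤ ofReal s ↔ r ≤ s := WithBot.coe_le_coe

theorem ofReal_lt {r s : ℝ} : ofReal r < ofReal s ↔ r < s := WithBot.coe_lt_coe

@[simp] theorem ofReal_zero : ofReal 0 = 1 := rfl

@[simp] theorem toReal_one : toReal 1 = 0 := rfl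

theorem ofReal_toReal {a : RMax} (ha : a ≠ 0) : ofReal a.toReal = a := by
  obtain rfl | ⟨r, rfl⟩ := eq_zero_or_ofReal a
  · exact absurd rfl ha
  · rfl

theorem prod_ofReal {ι : Type*} (s : Finset ι) (f : ι → ℝ) :
    ∏ i ∈ s, ofReal (f i) = ofReal (∑ i ∈ s, f i) := by
  classical
  induction s using Finset.induction_on with
  | empty => rfl
  | insert i s hi ih => rw [Finset.prod_insert hi, ih, ofReal_mul, Finset.sum_insert hi]

/-- The exponential, as a function from `RMax` to the nonnegative reals. -/
noncomputable def exp (a : RMax) : NNReal :=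
  match (show WithBot ℝ from a) with
  | none => 0
  | some r => ⟨Real.exp r, (Real.exp_pos r).le⟩

theorem exp_zero : exp 0 = 0 := rfl

theorem exp_ofReal (r : ℝ) : exp (ofReal r) = ⟨Real.exp r, (Real.exp_pos r).le⟩ := rfl

theorem exp_strictMono : StrictMono exp := by
  intro a b hab
  obtain rfl | ⟨s, rfl⟩ := eq_zero_or_ofReal b
  · exact absurd hab not_lt_zero
  obtain rfl | ⟨r, rfl⟩ := eq_zero_or_ofReal a
  · exact Real.exp_pos s
  · exact Real.exp_lt_exp.2 (ofReal_lt.1 hab)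

theorem exp_surjective : Function.Surjective exp := by
  intro y
  rcases eq_or_ne y 0 with rfl | hy
  · exact ⟨0, rfl⟩
  · exact ⟨ofReal (Real.log y), NNReal.eq (Real.exp_log (NNReal.coe_pos.2 (pos_iff_ne_zero.2 hy)))⟩

/-- The exponential, an order isomorphism from `RMax` onto the nonnegative reals. -/
noncomputable def expIso : RMax ≃o NNReal :=
  exp_strictMono.orderIsoOfSurjective exp exp_surjective

theorem expIso_zero : expIso 0 = 0 := exp_zero

theorem expIso_ofReal (r : ℝ) : expIso (ofReal r) = ⟨Real.exp r, (Real.exp_pos r).le⟩ :=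
  exp_ofReal r

theorem expIso_mul (a b : RMax) : expIso (a * b) = expIso a * expIso b := by
  obtain rfl | ⟨r, rfl⟩ := eq_zero_or_ofReal a
  · simp [expIso_zero]
  obtain rfl | ⟨s, rfl⟩ := eq_zero_or_ofReal b
  · simp [expIso_zero]
  rw [ofReal_mul, expIso_ofReal, expIso_ofReal, expIso_ofReal]
  exact NNReal.eq (Real.exp_add r s)

/-- Transporting the product to the nonnegative reals by the exponential takes care of continuity at
`ε`. -/
instance : ContinuousMul RMax where
  continuous_mul := by
    have h : (fun p : RMax × RMax => p.1 * p.2) =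
        fun p => expIso.symm (expIso p.1 * expIso p.2) := by
      funext p
      rw [← expIso_mul, OrderIso.symm_apply_apply]
    rw [h]
    exact expIso.symm.continuous.comp
      ((expIso.continuous.comp continuous_fst).mul (expIso.continuous.comp continuous_snd))

theorem isCompact_Icc (a b : RMax) : IsCompact (Set.Icc a b) := by
  have h := (CompactIccSpace.isCompact_Icc (a := expIso a) (b := expIso b)).image
    expIso.symm.continuous
  rwa [OrderIso.image_Icc, OrderIso.symm_apply_apply, OrderIso.symm_apply_apply] at h

theorem continuous_ofReal : Continuous ofReal := by
  have h : ofReal = fun r => expIso.symm ⟨Real.exp r, (Real.exp_pos _).le⟩ := by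
    funext r
    rw [← expIso_ofReal, OrderIso.symm_apply_apply]
  rw [h]
  exact expIso.symm.continuous.comp (Real.continuous_exp.subtype_mk _)

end RMax

/-! ### Multi-circuits as selections of one term per row -/

section Terms

variable {n : ℕ}

/-- The terms of row `i` of `A ⊕ lam ⊗ E` are indexed by `Option (Fin n)`: the index `some j` stands
for the entry of `A` in column `j`, and `none` for `lam` in column `i`. -/
def termCol (i : Fin n) (t : Option (Fin n)) : Fin n := t.getD i

/-- The coefficient of a term. -/
def termWt (A : MPMatrix n) (lam : RMax) (i : Fin n) (t : Option (Fin n)) : RMax :=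
  t.elim lam (A i)

/-- The value of a term at the vector `x`. -/
def termVal (A : MPMatrix n) (lam : RMax) (x : MPVec n) (i : Fin n) (t : Option (Fin n)) : RMax :=
  termWt A lam i t * x (termCol i t)

@[simp] theorem termCol_some (i j : Fin n) : termCol i (some j) = j := rfl
@[simp] theorem termCol_none (i : Fin n) : termCol i none = i := rfl
@[simp] theorem termWt_some (A : MPMatrix n) (lam : RMax) (i j : Fin n) :
    termWt A lam i (some j) = A i j := rfl
@[simp] theorem termWt_none (A : MPMatrix n) (lam : RMax) (i : Fin n) :
    termWt A lam i none = lam := rfl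
@[simp] theorem termVal_some (A : MPMatrix n) (lam : RMax) (x : MPVec n) (i j : Fin n) :
    termVal A lam x i (some j) = A i j * x j := rfl
@[simp] theorem termVal_none (A : MPMatrix n) (lam : RMax) (x : MPVec n) (i : Fin n) :
    termVal A lam x i none = lam * x i := rfl

theorem termVal_mono (A : MPMatrix n) (lam : RMax) {x y : MPVec n} (h : x ≤ y) (i : Fin n)
    (t : Option (Fin n)) : termVal A lam x i t ≤ termVal A lam y i t :=
  mul_le_mul_right (h _) _

namespace MultiCircuit

/-- The term of row `i` that is used by the multi-circuit. -/
def term (C : MultiCircuit n) (i : Fin n) : Option (Fin n) :=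
  if i ∈ C.verts then some (C.next i) else none

theorem term_of_mem {C : MultiCircuit n} {i : Fin n} (h : i ∈ C.verts) :
    C.term i = some (C.next i) := if_pos h

theorem term_of_notMem {C : MultiCircuit n} {i : Fin n} (h : i ∉ C.verts) :
    C.term i = none := if_neg h

theorem term_eq_none_iff {C : MultiCircuit n} {i : Fin n} : C.term i = none ↔ i ∉ C.verts := by
  by_cases h : i ∈ C.verts <;> simp [term, h]

@[simp] theorem termCol_term (C : MultiCircuit n) (i : Fin n) :
    termCol i (C.term i) = C.next i := by
  by_cases h : i ∈ C.verts
  · rw [term_of_mem h, termCol_some]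
  · rw [term_of_notMem h, termCol_none, C.next_eq i h]

/-- Keeping `none` apart from `some i` distinguishes a vertex off the multi-circuit from a loop,
although both lie in column i. -/
theorem term_injective : Function.Injective (term : MultiCircuit n → Fin n → Option (Fin n)) := by
  intro C C' h
  refine MultiCircuit.ext ?_ ?_
  · ext i
    rw [← not_iff_not, ← term_eq_none_iff, ← term_eq_none_iff, h]
  · ext i
    rw [← termCol_term, ← termCol_term, h]

instance : Finite (MultiCircuit n) := Finite.of_injective _ term_injective

/-- The multi-circuit that uses given terms in pairwise distinct columns. -/
noncomputable def ofTerm (f : Fin n → Option (Fin n))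
    (hf : Function.Injective fun i => termCol i (f i)) : MultiCircuit n where
  verts := Finset.univ.filter fun i => f i ≠ none
  next := Equiv.ofBijective _ (Finite.injective_iff_bijective.1 hf)
  next_eq i hi := by
    have : f i = none := by simpa using hi
    simp [this]

@[simp] theorem term_ofTerm (f : Fin n → Option (Fin n))
    (hf : Function.Injective fun i => termCol i (f i)) : (ofTerm f hf).term = f := by
  funext i
  rcases h : f i with _ | j
  · exact term_of_notMem (by simp [ofTerm, h])
  · rw [term_of_mem (by simp [ofTerm, h])]
    simp [ofTerm, h]

theorem length_eq_card (C : MultiCircuit n) :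
    C.length = (Finset.univ.filter fun i => C.term i ≠ none).card := by
  unfold length
  congr 1
  ext i
  simp [term_eq_none_iff]

/-- The total weight of the terms used by a multi-circuit. -/
noncomputable def totalWt (A : MPMatrix n) (lam : RMax) (C : MultiCircuit n) : RMax :=
  ∏ i, termWt A lam i (C.term i)

theorem totalWt_eq (A : MPMatrix n) (lam : RMax) (C : MultiCircuit n) :
    C.totalWt A lam = C.weight A * lam ^ (n - C.length) := by
  have h1 : ∏ i ∈ C.verts, termWt A lam i (C.term i) = C.weight A :=
    Finset.prod_congr rfl fun i hi => by rw [term_of_mem hi, termWt_some]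
  have h2 : ∏ i ∈ C.vertsᶜ, termWt A lam i (C.term i) = lam ^ (n - C.length) := by
    rw [Finset.prod_congr rfl fun i hi => by
      rw [term_of_notMem (Finset.mem_compl.1 hi), termWt_none], Finset.prod_const,
      Finset.card_compl, Fintype.card_fin, length]
  rw [totalWt, ← Finset.prod_mul_prod_compl C.verts, h1, h2]

theorem weight_ne_zero_iff {A : MPMatrix n} {C : MultiCircuit n} :
    C.weight A ≠ 0 ↔ C.InGraph A := by
  unfold weight InGraph edges
  rw [Finset.prod_ne_zero_iff]
  constructor
  · rintro h ⟨i, j⟩ ⟨hi, hj⟩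
    exact hj ▸ h i hi
  · intro h i hi
    exact h (i, C.next i) ⟨hi, rfl⟩

theorem totalWt_le_charpoly (A : MPMatrix n) (lam : RMax) (C : MultiCircuit n) :
    C.totalWt A lam ≤ mpCharpoly A lam := by
  refine le_trans ?_ (RMax.le_sum (f := fun p : Equiv.Perm (Fin n) =>
    ∏ i, (A + lam • (1 : MPMatrix n)) i (p i)) (Finset.mem_univ C.next))
  refine Finset.prod_le_prod' fun i _ => ?_
  by_cases h : i ∈ C.verts
  · rw [term_of_mem h, termWt_some]
    exact RMax.le_add_iff.2 (Or.inl le_rfl)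
  · rw [term_of_notMem h, termWt_none, C.next_eq i h]
    exact RMax.le_add_iff.2 (Or.inr (by simp))

/-- An optimal permutation becomes a multi-circuit once each fixed point is declared a loop or a
non-vertex, according to which of `A i i` and `lam` is larger. -/
theorem exists_charpoly_eq (A : MPMatrix n) (lam : RMax) :
    ∃ C : MultiCircuit n, mpCharpoly A lam ≤ C.totalWt A lam := by
  obtain ⟨p, -, hp⟩ := RMax.exists_mem_sum_eq (Finset.univ_nonempty (α := Equiv.Perm (Fin n)))
    fun p => ∏ i, (A + lam • (1 : MPMatrix n)) i (p i)
  have h : ∀ i, ∃ t, termCol i t = p i ∧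
      (A + lam • (1 : MPMatrix n)) i (p i) ≤ termWt A lam i t := by
    intro i
    by_cases hi : i = p i
    · rcases le_total (A i i) lam with h | h
      · refine ⟨none, hi, ?_⟩
        rw [← hi]
        exact RMax.add_le_iff.2 ⟨h, by simp⟩
      · refine ⟨some i, hi, ?_⟩
        rw [← hi]
        exact RMax.add_le_iff.2 ⟨le_rfl, by simpa using h⟩
    · refine ⟨some (p i), rfl, RMax.add_le_iff.2 ⟨le_rfl, ?_⟩⟩
      simp [Matrix.one_apply_ne hi]
  choose f hf hle using h
  have hinj : Function.Injective fun i => termCol i (f i) := by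
    simpa only [hf] using p.injective
  refine ⟨ofTerm f hinj, ?_⟩
  rw [totalWt, term_ofTerm]
  exact hp.le.trans (Finset.prod_le_prod' fun i _ => hle i)

theorem isMaximalReal_iff {A : MPMatrix n} {r : ℝ} {C : MultiCircuit n} :
    C.IsMaximalReal A r ↔
      ∀ C' : MultiCircuit n, C'.totalWt A (RMax.ofReal r) ≤ C.totalWt A (RMax.ofReal r) := by
  unfold IsMaximalReal
  rw [← totalWt_eq]
  constructor
  · rintro ⟨-, h⟩ C'
    exact h ▸ totalWt_le_charpoly A _ C'
  · intro h
    obtain ⟨C', hC'⟩ := exists_charpoly_eq A (RMax.ofReal r)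
    have he := le_antisymm (hC'.trans (h C')) (totalWt_le_charpoly A (RMax.ofReal r) C)
    refine ⟨?_, he⟩
    -- The empty multi-circuit has finite total weight, so a maximal one does too, and therefore
    -- lies in the graph.
    have hinj : Function.Injective fun i : Fin n => termCol i none := Function.injective_id
    have h0 : (ofTerm (fun _ : Fin n => none) hinj).totalWt A (RMax.ofReal r) ≠ 0 := by
      rw [totalWt, term_ofTerm]
      exact Finset.prod_ne_zero_iff.2 fun i _ => RMax.ofReal_ne_zero r
    have h1 := ((zero_lt_iff.2 h0).trans_le (h _)).ne'
    rw [totalWt_eq] at h1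
    exact weight_ne_zero_iff.1 (left_ne_zero_of_mul h1)

theorem isMaximal_ofReal_iff {A : MPMatrix n} {r : ℝ} {C : MultiCircuit n} :
    C.IsMaximal A (RMax.ofReal r) ↔ C.IsMaximalReal A r := by
  refine ⟨fun h => h.1 r rfl, fun h => ⟨fun s hs => ?_,
    fun h0 => absurd h0 (RMax.ofReal_ne_zero r)⟩⟩
  rwa [← RMax.ofReal_injective hs]

theorem IsMaximalReal.termWt_ne_zero {A : MPMatrix n} {r : ℝ} {C : MultiCircuit n}
    (h : C.IsMaximalReal A r) (i : Fin n) : termWt A (RMax.ofReal r) i (C.term i) ≠ 0 := by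
  by_cases hi : i ∈ C.verts
  · rw [term_of_mem hi, termWt_some]
    exact h.1 (i, C.next i) ⟨hi, rfl⟩
  · rw [term_of_notMem hi]
    exact RMax.ofReal_ne_zero r

/-- In every row, the term of `C` attains the maximum at `x`, and so does another term. -/
def IsBalanced (A : MPMatrix n) (lam : RMax) (C : MultiCircuit n) (x : MPVec n) : Prop :=
  ∀ i, (∀ t, termVal A lam x i t ≤ termVal A lam x i (C.term i)) ∧
    ∃ t, t ≠ C.term i ∧ termVal A lam x i t = termVal A lam x i (C.term i)

theorem mulVec_on (A : MPMatrix n) (lam : RMax) (C : MultiCircuit n) (x : MPVec n) (i : Fin n) :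
    (matOn A C + lam • unitOff C).mulVec x i = termVal A lam x i (C.term i) := by
  by_cases hi : i ∈ C.verts
  · rw [term_of_mem hi]
    simp [Matrix.mulVec, dotProduct, matOn, unitOff, edges, hi]
  · rw [term_of_notMem hi]
    simp [Matrix.mulVec, dotProduct, matOn, unitOff, edges, hi]

theorem mulVec_off (A : MPMatrix n) (lam : RMax) (C : MultiCircuit n) (x : MPVec n) (i : Fin n) :
    (matOff A C + lam • unitOn C).mulVec x i =
      ∑ t, if t = C.term i then 0 else termVal A lam x i t := by
  rw [Fintype.sum_option, add_comm]
  by_cases hi : i ∈ C.verts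
  · rw [term_of_mem hi]
    simp [Matrix.mulVec, dotProduct, matOff, unitOn, edges, hi, add_mul, Finset.sum_add_distrib]
  · rw [term_of_notMem hi]
    simp [Matrix.mulVec, dotProduct, matOff, unitOn, edges, hi]

/-- In row i the two sides of the defining equation are the term of C and the maximum of all
remaining terms. -/
theorem mem_circuitEigenspace_iff {A : MPMatrix n} {lam : RMax} {C : MultiCircuit n}
    {x : MPVec n} : x ∈ circuitEigenspace A lam C ↔ C.IsBalanced A lam x := by
  change _ = _ ↔ _
  rw [funext_iff]
  refine forall_congr' fun i => ?_
  rw [mulVec_on, mulVec_off]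
  constructor
  · intro h
    have hle : ∀ t, termVal A lam x i t ≤ termVal A lam x i (C.term i) := by
      intro t
      by_cases ht : t = C.term i
      · rw [ht]
      · rw [← h]
        refine le_trans ?_ (RMax.le_sum (Finset.mem_univ t))
        rw [if_neg ht]
    refine ⟨hle, ?_⟩
    obtain ⟨t, -, ht⟩ := RMax.exists_mem_sum_eq (Finset.univ_nonempty)
      fun t => if t = C.term i then 0 else termVal A lam x i t
    rw [h] at ht
    split_ifs at ht with h'
    · have : Nontrivial (Option (Fin n)) := ⟨none, some i, by simp⟩
      obtain ⟨s, hs⟩ := exists_ne (C.term i)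
      refine ⟨s, hs, le_antisymm (hle s) ?_⟩
      rw [ht]
      exact zero_le
    · exact ⟨t, h', ht.symm⟩
  · rintro ⟨hle, t, ht, he⟩
    refine le_antisymm (RMax.sum_le_iff.2 fun s _ => ?_) ?_
    · split_ifs
      · exact zero_le
      · exact hle s
    · rw [← he]
      refine le_trans ?_ (RMax.le_sum (Finset.mem_univ t))
      rw [if_neg ht]

theorem card_filter_next_mem (C : MultiCircuit n) (D : Finset (Fin n)) :
    (Finset.univ.filter fun i => C.next i ∈ D).card = D.card :=
  Finset.card_bij (fun i _ => C.next i) (fun i hi => (Finset.mem_filter.1 hi).2)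
    (fun i _ j _ h => C.next.injective h)
    (fun j hj => ⟨C.next.symm j, by simpa using hj, by simp⟩)

theorem injective_reroute {C : MultiCircuit n} {D : Finset (Fin n)} {T : Fin n → Option (Fin n)}
    (hmaps : ∀ i, C.next i ∈ D → termCol i (T i) ∈ D)
    (hinj : Set.InjOn (fun i => termCol i (T i)) {i | C.next i ∈ D}) :
    Function.Injective fun i => termCol i (if C.next i ∈ D then T i else C.term i) := by
  intro i j hij
  by_cases hi : C.next i ∈ D <;> by_cases hj : C.next j ∈ D <;>
    simp only [hi, hj, if_true, if_false, termCol_term] at hij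
  · exact hinj hi hj hij
  · exact absurd (hij ▸ hmaps i hi) hj
  · exact absurd (hij ▸ hmaps j hj) hi
  · exact C.next.injective hij

/-- The multi-circuit obtained by using the terms `T` instead of those of `C` in all rows in which
`C` uses a column in `D`. -/
noncomputable def reroute (C : MultiCircuit n) (D : Finset (Fin n)) (T : Fin n → Option (Fin n))
    (hmaps : ∀ i, C.next i ∈ D → termCol i (T i) ∈ D)
    (hinj : Set.InjOn (fun i => termCol i (T i)) {i | C.next i ∈ D}) : MultiCircuit n :=
  ofTerm _ (injective_reroute hmaps hinj)

section Reroute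

variable {C : MultiCircuit n} {D : Finset (Fin n)} {T : Fin n → Option (Fin n)}

theorem term_reroute
    (hmaps : ∀ i, C.next i ∈ D → termCol i (T i) ∈ D)
    (hinj : Set.InjOn (fun i => termCol i (T i)) {i | C.next i ∈ D}) (i : Fin n) :
    (C.reroute D T hmaps hinj).term i = if C.next i ∈ D then T i else C.term i := by
  rw [reroute, term_ofTerm]

theorem totalWt_reroute
    (hmaps : ∀ i, C.next i ∈ D → termCol i (T i) ∈ D)
    (hinj : Set.InjOn (fun i => termCol i (T i)) {i | C.next i ∈ D})
    (A : MPMatrix n) (lam : RMax) :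
    (C.reroute D T hmaps hinj).totalWt A lam *
        ∏ i with C.next i ∈ D, termWt A lam i (C.term i) =
      C.totalWt A lam * ∏ i with C.next i ∈ D, termWt A lam i (T i) := by
  unfold totalWt
  rw [← Finset.prod_filter_mul_prod_filter_not Finset.univ (fun i => C.next i ∈ D),
    ← Finset.prod_filter_mul_prod_filter_not Finset.univ (fun i => C.next i ∈ D)
      (fun i => termWt A lam i (C.term i))]
  have h1 : ∏ i with C.next i ∈ D, termWt A lam i ((C.reroute D T hmaps hinj).term i) =
      ∏ i with C.next i ∈ D, termWt A lam i (T i) :=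
    Finset.prod_congr rfl fun i hi => by
      rw [term_reroute, if_pos (Finset.mem_filter.1 hi).2]
  have h2 : ∏ i with ¬ C.next i ∈ D, termWt A lam i ((C.reroute D T hmaps hinj).term i) =
      ∏ i with ¬ C.next i ∈ D, termWt A lam i (C.term i) :=
    Finset.prod_congr rfl fun i hi => by
      rw [term_reroute, if_neg (Finset.mem_filter.1 hi).2]
  rw [h1, h2]
  ring

theorem prod_termVal_term (A : MPMatrix n) (lam : RMax) (x : MPVec n) (C : MultiCircuit n)
    (D : Finset (Fin n)) :
    ∏ i with C.next i ∈ D, termVal A lam x i (C.term i) =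
      (∏ i with C.next i ∈ D, termWt A lam i (C.term i)) * ∏ j ∈ D, x j := by
  unfold termVal
  rw [Finset.prod_mul_distrib]
  congr 1
  simp only [termCol_term]
  exact Finset.prod_bij (fun i _ => C.next i) (fun i hi => (Finset.mem_filter.1 hi).2)
    (fun i _ j _ h => C.next.injective h)
    (fun j hj => ⟨C.next.symm j, by simpa using hj, by simp⟩) (fun _ _ => rfl)

/-- The new terms again hit each column of D once, so x contributes the same factor as for C.
Comparing values at x thus amounts to comparing weights. -/
theorem prod_termVal_reroute
    (hmaps : ∀ i, C.next i ∈ D → termCol i (T i) ∈ D)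
    (hinj : Set.InjOn (fun i => termCol i (T i)) {i | C.next i ∈ D}) (A : MPMatrix n) (lam : RMax)
    (x : MPVec n) :
    ∏ i with C.next i ∈ D, termVal A lam x i (T i) =
      (∏ i with C.next i ∈ D, termWt A lam i (T i)) * ∏ j ∈ D, x j := by
  unfold termVal
  rw [Finset.prod_mul_distrib]
  congr 1
  have hinj' : Set.InjOn (fun i => termCol i (T i))
      (Finset.univ.filter fun i => C.next i ∈ D : Finset (Fin n)) := by
    simpa using hinj
  have himg : (Finset.univ.filter fun i => C.next i ∈ D).image (fun i => termCol i (T i)) = D := by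
    refine Finset.eq_of_subset_of_card_le ?_ ?_
    · intro j hj
      obtain ⟨i, hi, rfl⟩ := Finset.mem_image.1 hj
      exact hmaps i (Finset.mem_filter.1 hi).2
    · rw [Finset.card_image_of_injOn hinj', card_filter_next_mem]
  rw [← himg, Finset.prod_image hinj', himg]

theorem totalWt_reroute_of_eq
    (hmaps : ∀ i, C.next i ∈ D → termCol i (T i) ∈ D)
    (hinj : Set.InjOn (fun i => termCol i (T i)) {i | C.next i ∈ D})
    {A : MPMatrix n} {lam : RMax} {x : MPVec n} {c : RMax}
    (hx : ∀ j ∈ D, x j ≠ 0) (hwt : ∀ i, C.next i ∈ D → termWt A lam i (C.term i) ≠ 0)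
    (hT : ∀ i, C.next i ∈ D → termVal A lam x i (T i) = c * termVal A lam x i (C.term i)) :
    (C.reroute D T hmaps hinj).totalWt A lam =
      c ^ (Finset.univ.filter fun i => C.next i ∈ D).card * C.totalWt A lam := by
  have h1 : ∏ i with C.next i ∈ D, termVal A lam x i (T i) =
      c ^ (Finset.univ.filter fun i => C.next i ∈ D).card *
        ∏ i with C.next i ∈ D, termVal A lam x i (C.term i) := by
    rw [← Finset.prod_const, ← Finset.prod_mul_distrib]
    exact Finset.prod_congr rfl fun i hi => hT i (Finset.mem_filter.1 hi).2
  rw [prod_termVal_reroute hmaps hinj, prod_termVal_term, ← mul_assoc] at h1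
  have h2 := mul_right_cancel₀ (Finset.prod_ne_zero_iff.2 hx) h1
  have h3 := totalWt_reroute hmaps hinj A lam
  rw [h2, ← mul_assoc, mul_comm (C.totalWt A lam)] at h3
  exact mul_right_cancel₀
    (Finset.prod_ne_zero_iff.2 fun i hi => hwt i (Finset.mem_filter.1 hi).2) h3

end Reroute

end MultiCircuit

end Terms

/-! ### Periodic orbits and switching a multi-circuit along them -/

section Orbits

variable {n : ℕ}

open scoped Classical in
/-- The forward orbit of a point under a map. -/
noncomputable def fwdOrbit (F : Fin n → Fin n) (w : Fin n) : Finset (Fin n) :=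
  Finset.univ.filter fun v => ∃ k, F^[k] w = v

theorem mem_fwdOrbit {F : Fin n → Fin n} {v w : Fin n} :
    v ∈ fwdOrbit F w ↔ ∃ k, F^[k] w = v := by
  simp [fwdOrbit]

theorem self_mem_fwdOrbit (F : Fin n → Fin n) (w : Fin n) : w ∈ fwdOrbit F w :=
  mem_fwdOrbit.2 ⟨0, rfl⟩

theorem apply_mem_fwdOrbit {F : Fin n → Fin n} {v w : Fin n} (h : v ∈ fwdOrbit F w) :
    F v ∈ fwdOrbit F w := by
  obtain ⟨k, rfl⟩ := mem_fwdOrbit.1 h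
  exact mem_fwdOrbit.2 ⟨k + 1, Function.iterate_succ_apply' F k w⟩

theorem fwdOrbit_induction {F : Fin n → Fin n} {w : Fin n} {p : Fin n → Prop} (h0 : p w)
    (hs : ∀ v, p v → p (F v)) {v : Fin n} (hv : v ∈ fwdOrbit F w) : p v := by
  obtain ⟨k, rfl⟩ := mem_fwdOrbit.1 hv
  induction k with
  | zero => exact h0
  | succ k ih =>
    rw [Function.iterate_succ_apply']
    exact hs _ (ih (mem_fwdOrbit.2 ⟨k, rfl⟩))

theorem fwdOrbit_subset {F : Fin n → Fin n} {v w : Fin n} (h : v ∈ fwdOrbit F w) :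
    fwdOrbit F v ⊆ fwdOrbit F w := fun _ hu =>
  fwdOrbit_induction (p := (· ∈ fwdOrbit F w)) h (fun _ => apply_mem_fwdOrbit) hu

theorem exists_periodic_mem_fwdOrbit (F : Fin n → Fin n) (u : Fin n) :
    ∃ w ∈ fwdOrbit F u, w ∈ Function.periodicPts F := by
  obtain ⟨k, l, hkl, h⟩ := Finite.exists_ne_map_eq_of_infinite fun k : ℕ => F^[k] u
  wlog hlt : k < l generalizing k l
  · exact this l k hkl.symm h.symm (lt_of_le_of_ne (not_lt.1 hlt) hkl.symm)
  refine ⟨F^[k] u, mem_fwdOrbit.2 ⟨k, rfl⟩, Function.mk_mem_periodicPts (Nat.sub_pos_of_lt hlt) ?_⟩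
  change F^[l - k] (F^[k] u) = F^[k] u
  rw [← Function.iterate_add_apply, Nat.sub_add_cancel hlt.le]
  exact h.symm

theorem isPeriodicPt_of_mem_fwdOrbit {F : Fin n → Fin n} {v w : Fin n} {p : ℕ}
    (hw : Function.IsPeriodicPt F p w) (hv : v ∈ fwdOrbit F w) : Function.IsPeriodicPt F p v := by
  obtain ⟨k, rfl⟩ := mem_fwdOrbit.1 hv
  exact hw.apply_iterate k

theorem injOn_fwdOrbit {F : Fin n → Fin n} {w : Fin n} (hw : w ∈ Function.periodicPts F) :
    Set.InjOn F (fwdOrbit F w) := by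
  obtain ⟨p, hp, hper⟩ := hw
  intro a ha b hb hab
  exact (isPeriodicPt_of_mem_fwdOrbit hper ha).eq_of_apply_eq_same
    (isPeriodicPt_of_mem_fwdOrbit hper hb) hp hab

theorem exists_apply_eq_of_mem_fwdOrbit {F : Fin n → Fin n} {v w : Fin n}
    (hw : w ∈ Function.periodicPts F) (hv : v ∈ fwdOrbit F w) : ∃ u ∈ fwdOrbit F w, F u = v := by
  obtain ⟨p, hp, hper⟩ := hw
  refine ⟨F^[p - 1] v, fwdOrbit_subset hv (mem_fwdOrbit.2 ⟨_, rfl⟩), ?_⟩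
  rw [← Function.iterate_succ_apply' F, Nat.succ_eq_add_one, Nat.sub_add_cancel hp]
  exact isPeriodicPt_of_mem_fwdOrbit hper hv

namespace MultiCircuit

/-- A periodic orbit is an elementary circuit. -/
theorem exists_elementary_of_periodic {F : Fin n → Fin n} {w : Fin n}
    (hw : w ∈ Function.periodicPts F) :
    ∃ D : MultiCircuit n, D.IsElementary ∧ D.verts = fwdOrbit F w ∧
      ∀ v ∈ fwdOrbit F w, D.next v = F v := by
  have hinj : Function.Injective fun i =>
      termCol i (if i ∈ fwdOrbit F w then some (F i) else none) := by
    intro i j hij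
    by_cases hi : i ∈ fwdOrbit F w <;> by_cases hj : j ∈ fwdOrbit F w <;>
      simp only [hi, hj, if_true, if_false, termCol_some, termCol_none] at hij
    · exact injOn_fwdOrbit hw hi hj hij
    · exact absurd (hij ▸ apply_mem_fwdOrbit hi) hj
    · exact absurd (hij ▸ apply_mem_fwdOrbit hj) hi
    · exact hij
  have hnext : ∀ v ∈ fwdOrbit F w, (ofTerm _ hinj).next v = F v := by
    intro v hv
    rw [← termCol_term, term_ofTerm, if_pos hv, termCol_some]
  have hverts : (ofTerm _ hinj).verts = fwdOrbit F w := by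
    ext v
    rw [← not_iff_not, ← term_eq_none_iff, term_ofTerm]
    by_cases hv : v ∈ fwdOrbit F w <;> simp [hv]
  refine ⟨ofTerm _ hinj, ⟨?_, ?_, ?_⟩, hverts, hnext⟩
  · rw [hverts]
    exact ⟨w, self_mem_fwdOrbit F w⟩
  · rw [hverts]
    refine ⟨fun v hv => ?_, (ofTerm _ hinj).next.injective.injOn, fun v hv => ?_⟩
    · rw [hnext v hv]
      exact apply_mem_fwdOrbit hv
    · obtain ⟨u, hu, rfl⟩ := exists_apply_eq_of_mem_fwdOrbit hw hv
      exact ⟨u, hu, hnext u hu⟩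
  · have key : ∀ v ∈ fwdOrbit F w, (ofTerm _ hinj).next.SameCycle w v := fun v hv =>
      (fwdOrbit_induction (p := fun v => v ∈ fwdOrbit F w ∧ (ofTerm _ hinj).next.SameCycle w v)
        ⟨self_mem_fwdOrbit F w, Equiv.Perm.SameCycle.rfl⟩
        (fun v hv => ⟨apply_mem_fwdOrbit hv.1, by
          rw [← hnext v hv.1]
          exact Equiv.Perm.sameCycle_apply_right.2 hv.2⟩) hv).2
    rw [hverts]
    exact fun a ha b hb => (key a ha).symm.trans (key b hb)

/-- The column of the term `T` in the row in which `C` uses the column `v`. -/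
def succ (C : MultiCircuit n) (T : Fin n → Option (Fin n)) (v : Fin n) : Fin n :=
  termCol (C.next.symm v) (T (C.next.symm v))

@[simp] theorem succ_next (C : MultiCircuit n) (T : Fin n → Option (Fin n)) (i : Fin n) :
    C.succ T (C.next i) = termCol i (T i) := by
  simp [succ]

section

variable {C : MultiCircuit n} {T : Fin n → Option (Fin n)} {w : Fin n}

theorem mapsTo_fwdOrbit_succ (C : MultiCircuit n) (T : Fin n → Option (Fin n)) (w i : Fin n)
    (hi : C.next i ∈ fwdOrbit (C.succ T) w) : termCol i (T i) ∈ fwdOrbit (C.succ T) w := by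
  rw [← succ_next C]
  exact apply_mem_fwdOrbit hi

theorem injOn_fwdOrbit_succ (hw : w ∈ Function.periodicPts (C.succ T)) :
    Set.InjOn (fun i => termCol i (T i)) {i | C.next i ∈ fwdOrbit (C.succ T) w} := by
  intro i hi j hj hij
  simp only [← succ_next C] at hij
  exact C.next.injective (injOn_fwdOrbit hw hi hj hij)

/-- The multi-circuit obtained from `C` by switching to the terms `T` along a periodic orbit. -/
noncomputable def switch (C : MultiCircuit n) (T : Fin n → Option (Fin n)) (w : Fin n)
    (hw : w ∈ Function.periodicPts (C.succ T)) : MultiCircuit n :=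
  C.reroute (fwdOrbit (C.succ T) w) T (mapsTo_fwdOrbit_succ C T w) (injOn_fwdOrbit_succ hw)

theorem term_switch (hw : w ∈ Function.periodicPts (C.succ T)) (i : Fin n) :
    (C.switch T w hw).term i = if C.next i ∈ fwdOrbit (C.succ T) w then T i else C.term i :=
  term_reroute _ _ i

theorem switch_ne (hT : ∀ i, T i ≠ C.term i) (hw : w ∈ Function.periodicPts (C.succ T)) :
    C.switch T w hw ≠ C := by
  intro h
  have h1 := congrArg (fun C => term C (C.next.symm w)) h
  simp only [h] at h1
  have h2 := term_switch hw (C.next.symm w)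
  rw [h, if_pos (by simpa using self_mem_fwdOrbit _ w)] at h2
  exact hT _ h2.symm

theorem totalWt_switch {A : MPMatrix n} {lam : RMax} {x : MPVec n} {c : RMax}
    (hw : w ∈ Function.periodicPts (C.succ T))
    (hx : ∀ j ∈ fwdOrbit (C.succ T) w, x j ≠ 0)
    (hwt : ∀ i, C.next i ∈ fwdOrbit (C.succ T) w → termWt A lam i (C.term i) ≠ 0)
    (hT : ∀ i, C.next i ∈ fwdOrbit (C.succ T) w →
      termVal A lam x i (T i) = c * termVal A lam x i (C.term i)) :
    (C.switch T w hw).totalWt A lam =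
      c ^ (Finset.univ.filter fun i => C.next i ∈ fwdOrbit (C.succ T) w).card *
        C.totalWt A lam :=
  totalWt_reroute_of_eq _ _ hx hwt hT

end

/-- Both permutations enter D from exactly `D.card` rows, so the inclusion of these sets of rows is
an equality. -/
theorem next_mem_of_imp {C C' : MultiCircuit n} {D : Finset (Fin n)}
    (h : ∀ i, C.next i ∈ D → C'.next i ∈ D) (i : Fin n) (hi : C'.next i ∈ D) : C.next i ∈ D := by
  have he : (Finset.univ.filter fun i => C.next i ∈ D) =
      Finset.univ.filter fun i => C'.next i ∈ D := by
    refine Finset.eq_of_subset_of_card_le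
      (Finset.monotone_filter_right _ fun i _ hi => h i hi) ?_
    rw [card_filter_next_mem, card_filter_next_mem]
  have : i ∈ Finset.univ.filter fun i => C'.next i ∈ D := by simpa using hi
  rw [← he] at this
  simpa using this

/-- Every maximal multi-circuit uses only maximal terms. -/
theorem IsBalanced.termVal_eq {A : MPMatrix n} {r : ℝ} {C C' : MultiCircuit n} {x : MPVec n}
    (hx : C.IsBalanced A (RMax.ofReal r) x) (hC' : C'.IsMaximalReal A r)
    (i : Fin n) :
    termVal A (RMax.ofReal r) x i (C'.term i) = termVal A (RMax.ofReal r) x i (C.term i) := by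
  classical
  -- On the support of x values can be cancelled; off it they are `ε`.
  set D : Finset (Fin n) := Finset.univ.filter fun j => x j ≠ 0 with hD
  have hmem : ∀ j, j ∈ D ↔ x j ≠ 0 := by simp [hD]
  have himp : ∀ i, C'.next i ∈ D → C.next i ∈ D := by
    intro i hi
    rw [hmem] at hi ⊢
    intro h0
    have h1 := (hx i).1 (C'.term i)
    unfold termVal at h1
    rw [termCol_term, termCol_term, h0, mul_zero, le_zero_iff] at h1
    exact mul_ne_zero (hC'.termWt_ne_zero i) hi h1
  by_contra hne
  have hlt := lt_of_le_of_ne ((hx i).1 (C'.term i)) hne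
  have hi : C'.next i ∈ D := by
    refine next_mem_of_imp himp i ((hmem _).2 fun h0 => ?_)
    unfold termVal at hlt
    rw [termCol_term C, h0, mul_zero] at hlt
    exact not_lt_zero hlt
  have hinj : Set.InjOn (fun i => termCol i (C.term i)) {i | C'.next i ∈ D} := by
    simpa only [termCol_term] using C.next.injective.injOn
  have hmaps : ∀ i, C'.next i ∈ D → termCol i (C.term i) ∈ D := by
    simpa only [termCol_term] using himp
  -- If some term of C' were not maximal, replacing its terms by those of C over the support of x
  -- would increase its weight.
  have h1 := totalWt_reroute hmaps hinj A (RMax.ofReal r)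
  have h2 := isMaximalReal_iff.1 hC' (C'.reroute D C.term hmaps hinj)
  have hpos : 0 < C'.totalWt A (RMax.ofReal r) :=
    zero_lt_iff.2 (Finset.prod_ne_zero_iff.2 fun i _ => hC'.termWt_ne_zero i)
  have h3 : ∏ i with C'.next i ∈ D, termWt A (RMax.ofReal r) i (C.term i) ≤
      ∏ i with C'.next i ∈ D, termWt A (RMax.ofReal r) i (C'.term i) := by
    refine le_of_mul_le_mul_left ?_ hpos
    rw [← h1]
    exact mul_le_mul_left h2 _
  have h4 := mul_le_mul_left h3 (∏ j ∈ D, x j)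
  rw [← prod_termVal_term, ← prod_termVal_reroute hmaps hinj] at h4
  refine absurd h4 (not_le.2 (Finset.prod_lt_prod ?_ (fun i _ => (hx i).1 _)
    ⟨i, by simpa using hi, hlt⟩))
  intro j hj
  refine zero_lt_iff.2 (mul_ne_zero (hC'.termWt_ne_zero j) ?_)
  rw [termCol_term]
  exact (hmem _).1 (Finset.mem_filter.1 hj).2

/-- Where the two multi-circuits use different terms, these are two maximal ones; elsewhere the
second term for C serves C'. So balance does not depend on the maximal multi-circuit. -/
theorem IsBalanced.of_isMaximalReal {A : MPMatrix n} {r : ℝ} {C C' : MultiCircuit n}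
    {x : MPVec n} (hx : C.IsBalanced A (RMax.ofReal r) x) (hC' : C'.IsMaximalReal A r) :
    C'.IsBalanced A (RMax.ofReal r) x := by
  intro i
  rw [hx.termVal_eq hC' i]
  refine ⟨(hx i).1, ?_⟩
  by_cases h : C.term i = C'.term i
  · rw [← h]
    exact (hx i).2
  · exact ⟨C.term i, h, rfl⟩

end MultiCircuit

end Orbits

/-! ### Existence of generic perturbation directions -/

section Generic

variable {n : ℕ}

namespace MultiCircuit

theorem IsMaximal.exists_isMaximalReal {A : MPMatrix n} {lam : RMax} {C C' : MultiCircuit n}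
    (hC : C.IsMaximal A lam) (hC' : C'.IsMaximal A lam) :
    ∃ r, C.IsMaximalReal A r ∧ C'.IsMaximalReal A r := by
  obtain rfl | ⟨r, rfl⟩ := RMax.eq_zero_or_ofReal lam
  · exact ((hC.2 rfl).and (hC'.2 rfl)).exists
  · exact ⟨r, hC.1 r rfl, hC'.1 r rfl⟩

/-- The sum of the perturbation directions on the edges. -/
noncomputable def edgeSum (zeta : Matrix (Fin n) (Fin n) ℝ) (C : MultiCircuit n) : ℝ :=
  ∑ i ∈ C.verts, zeta i (C.next i)

theorem weight_perturb (A : MPMatrix n) (zeta : Matrix (Fin n) (Fin n) ℝ) (delta : ℝ)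
    (C : MultiCircuit n) :
    C.weight (perturb A zeta delta) = C.weight A * RMax.ofReal (-(C.edgeSum zeta * delta)) := by
  unfold weight edgeSum perturb
  simp only [Matrix.of_apply]
  rw [Finset.prod_mul_distrib, RMax.prod_ofReal, Finset.sum_neg_distrib, Finset.sum_mul]

/-- The two weights are affine in `delta` with different slopes, so they agree for at most one
`delta`. -/
theorem eventually_weight_perturb_ne (A : MPMatrix n) {zeta : Matrix (Fin n) (Fin n) ℝ}
    (hz : Function.Injective (edgeSum zeta)) :
    ∀ᶠ delta in 𝓝[>] (0 : ℝ), ∀ C C' : MultiCircuit n, C ≠ C' → C.weight A ≠ 0 →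
      C'.weight A ≠ 0 → C.weight (perturb A zeta delta) ≠ C'.weight (perturb A zeta delta) := by
  refine eventually_all.2 fun C => eventually_all.2 fun C' => ?_
  by_cases hne : C = C'
  · exact Eventually.of_forall fun _ h => absurd hne h
  by_cases h0 : C.weight A = 0
  · exact Eventually.of_forall fun _ _ h => absurd h0 h
  by_cases h0' : C'.weight A = 0
  · exact Eventually.of_forall fun _ _ _ h => absurd h0' h
  have hz' : C.edgeSum zeta - C'.edgeSum zeta ≠ 0 := sub_ne_zero.2 fun h => hne (hz h)
  have hev : ∀ᶠ delta in 𝓝[>] (0 : ℝ),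
      delta ≠ ((C.weight A).toReal - (C'.weight A).toReal) /
        (C.edgeSum zeta - C'.edgeSum zeta) := by
    by_cases hc : ((C.weight A).toReal - (C'.weight A).toReal) /
        (C.edgeSum zeta - C'.edgeSum zeta) = 0
    · rw [hc]
      exact eventually_mem_nhdsWithin.mono fun d (hd : 0 < d) => hd.ne'
    · exact nhdsWithin_le_nhds (eventually_ne_nhds (Ne.symm hc))
  refine hev.mono fun delta hd _ _ _ he => hd ?_
  rw [weight_perturb, weight_perturb, ← RMax.ofReal_toReal h0, ← RMax.ofReal_toReal h0',
    RMax.ofReal_mul, RMax.ofReal_mul, RMax.ofReal_inj] at he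
  rw [eq_div_iff hz']
  change (C.weight A).toReal + _ = (C'.weight A).toReal + _ at he
  linarith

/-- At equal lengths the power of the parameter cancels, so two maximal multi-circuits would have
equal weight. -/
theorem distinctLengths_of_weight_ne {A B : MPMatrix n}
    (hAB : ∀ C : MultiCircuit n, C.weight B ≠ 0 → C.weight A ≠ 0)
    (h : ∀ C C' : MultiCircuit n, C ≠ C' → C.weight A ≠ 0 → C'.weight A ≠ 0 →
      C.weight B ≠ C'.weight B) : DistinctLengths B := by
  intro lam C C' hC hC' hne hlen
  obtain ⟨r, h1, h2⟩ := hC.exists_isMaximalReal hC'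
  refine h C C' hne (hAB C (weight_ne_zero_iff.2 h1.1)) (hAB C' (weight_ne_zero_iff.2 h2.1)) ?_
  have he := h1.2.symm.trans h2.2
  rw [hlen] at he
  exact mul_right_cancel₀ (pow_ne_zero _ (RMax.ofReal_ne_zero r)) he

/-- Edges carry distinct powers of two, so binary expansion recovers the edge set, and with it the
multi-circuit. -/
theorem edgeSum_injective_two_pow (c : ℝ) (hc : c ≠ 0) :
    Function.Injective (edgeSum fun i j : Fin n =>
      (2 : ℝ) ^ (finProdFinEquiv (i, j) : ℕ) * c) := by
  intro C C' h
  unfold edgeSum at h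
  rw [← Finset.sum_mul, ← Finset.sum_mul] at h
  have h1 := mul_right_cancel₀ hc h
  have key : ∀ C : MultiCircuit n,
      ∑ i ∈ C.verts, (2 : ℝ) ^ (finProdFinEquiv (i, C.next i) : ℕ) =
        ((∑ k ∈ C.verts.image fun i => (finProdFinEquiv (i, C.next i) : ℕ), 2 ^ k : ℕ) : ℝ) := by
    intro C
    rw [Finset.sum_image]
    · push_cast
      rfl
    · intro i _ j _ hij
      exact (Prod.ext_iff.1 (finProdFinEquiv.injective (Fin.val_injective hij))).1
  rw [key, key, Nat.cast_inj] at h1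
  have h2 := Finset.geomSum_injective le_rfl h1
  have h3 : ∀ {C C' : MultiCircuit n},
      (C.verts.image fun i => (finProdFinEquiv (i, C.next i) : ℕ)) =
        C'.verts.image (fun i => (finProdFinEquiv (i, C'.next i) : ℕ)) →
      ∀ i ∈ C.verts, i ∈ C'.verts ∧ C.next i = C'.next i := by
    intro C C' h i hi
    have : (finProdFinEquiv (i, C.next i) : ℕ) ∈
        C'.verts.image (fun i => (finProdFinEquiv (i, C'.next i) : ℕ)) :=
      h ▸ Finset.mem_image_of_mem _ hi
    obtain ⟨j, hj, hij⟩ := Finset.mem_image.1 this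
    have := Prod.ext_iff.1 (finProdFinEquiv.injective (Fin.val_injective hij))
    obtain rfl : j = i := this.1
    exact ⟨hj, this.2.symm⟩
  refine MultiCircuit.ext ?_ ?_
  · exact Finset.Subset.antisymm (fun i hi => (h3 h2 i hi).1) fun i hi => (h3 h2.symm i hi).1
  · ext i
    by_cases hi : i ∈ C.verts
    · rw [(h3 h2 i hi).2]
    · rw [C.next_eq i hi, C'.next_eq i fun hi' => hi (h3 h2.symm i hi').1]

end MultiCircuit

theorem genericDirections_nonempty (A : MPMatrix n) : (genericDirections A).Nonempty := by
  -- This factor scales the powers of two, whose exponents are below n², into [0, 1].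
  have hc : (2 : ℝ)⁻¹ ^ (n * n) ≠ 0 := by positivity
  refine ⟨fun i j => (2 : ℝ) ^ (finProdFinEquiv (i, j) : ℕ) * (2 : ℝ)⁻¹ ^ (n * n),
    fun i j => ⟨by positivity, ?_⟩, ?_⟩
  · rw [inv_pow, mul_inv_le_iff₀ (by positivity), one_mul]
    exact pow_le_pow_right₀ one_le_two (finProdFinEquiv (i, j)).isLt.le
  · obtain ⟨u, hu, h⟩ := mem_nhdsGT_iff_exists_Ioo_subset.1
      (MultiCircuit.eventually_weight_perturb_ne A
        (MultiCircuit.edgeSum_injective_two_pow (n := n) _ hc))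
    refine ⟨u, hu, fun delta h0 h1 => MultiCircuit.distinctLengths_of_weight_ne ?_ (h ⟨h0, h1⟩)⟩
    intro C hC
    exact left_ne_zero_of_mul fun h => hC ((MultiCircuit.weight_perturb A _ delta C).trans h)

end Generic

/-! ### Limits of balanced vectors -/

section Limits

variable {n : ℕ}

/-- Each coordinate of a max-plus sum comes from one summand, and all summands lie below the sum. -/
theorem exists_le_of_mem_iSup {ι : Sort*} {W : ι → Submodule RMax (MPVec n)} {y : MPVec n}
    (hy : y ∈ ⨆ i, W i) {u : Fin n} (hu : y u ≠ 0) :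
    ∃ i, ∃ w ∈ W i, w ≤ y ∧ w u = y u := by
  revert u
  refine Submodule.iSup_induction W (motive := fun y => ∀ {u}, y u ≠ 0 →
    ∃ i, ∃ w ∈ W i, w ≤ y ∧ w u = y u) hy (fun i x hx _ _ => ⟨i, x, hx, le_rfl, rfl⟩)
    (fun hu => absurd rfl hu) ?_
  intro x y hx hy u hu
  have key : (x + y) u = max (x u) (y u) := rfl
  rcases le_total (x u) (y u) with h | h
  · rw [max_eq_right h] at key
    obtain ⟨i, w, hw, hle, he⟩ := hy (key ▸ hu)
    exact ⟨i, w, hw, fun j => (hle j).trans (le_max_right (x j) (y j)), he.trans key.symm⟩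
  · rw [max_eq_left h] at key
    obtain ⟨i, w, hw, hle, he⟩ := hx (key ▸ hu)
    exact ⟨i, w, hw, fun j => (hle j).trans (le_max_left (x j) (y j)), he.trans key.symm⟩

namespace MultiCircuit

/-- At `x`, the terms of `C` attain the maxima of the rows, and so do the other terms `T`. -/
def IsBalancedBy (A : MPMatrix n) (lam : RMax) (C : MultiCircuit n) (x : MPVec n)
    (T : Fin n → Option (Fin n)) : Prop :=
  ∀ i, T i ≠ C.term i ∧ (∀ t, termVal A lam x i t ≤ termVal A lam x i (C.term i)) ∧
    termVal A lam x i (T i) = termVal A lam x i (C.term i)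

theorem IsBalancedBy.isBalanced {A : MPMatrix n} {lam : RMax} {C : MultiCircuit n} {x : MPVec n}
    {T : Fin n → Option (Fin n)} (h : C.IsBalancedBy A lam x T) : C.IsBalanced A lam x :=
  fun i => ⟨(h i).2.1, T i, (h i).1, (h i).2.2⟩

theorem IsBalanced.exists_isBalancedBy {A : MPMatrix n} {lam : RMax} {C : MultiCircuit n}
    {x : MPVec n} (h : C.IsBalanced A lam x) : ∃ T, C.IsBalancedBy A lam x T := by
  choose T h1 h2 using fun i => (h i).2
  exact ⟨T, fun i => ⟨h1 i, (h i).1, h2 i⟩⟩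

end MultiCircuit

theorem exists_of_mem_perturbedSum {A : MPMatrix n} {lam : RMax}
    {zeta : Matrix (Fin n) (Fin n) ℝ} {delta : ℝ} {y : MPVec n}
    (hy : y ∈ perturbedSum A lam zeta delta) {u : Fin n} (hu : y u ≠ 0) :
    ∃ (p : MultiCircuit n × (Fin n → Option (Fin n))) (q : RMax × MPVec n),
      q.1 ∈ rmaxBall lam (n * delta) ∧ p.1.IsMaximal (perturb A zeta delta) q.1 ∧
      p.1.IsBalancedBy (perturb A zeta delta) q.1 q.2 p.2 ∧ q.2 ≤ y ∧ q.2 u = y u := by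
  obtain ⟨lam', w1, hw1, hle1, he1⟩ := exists_le_of_mem_iSup hy hu
  rw [← he1] at hu
  obtain ⟨hlam', w2, hw2, hle2, he2⟩ := exists_le_of_mem_iSup hw1 hu
  rw [← he2] at hu
  obtain ⟨C, w3, hw3, hle3, he3⟩ := exists_le_of_mem_iSup hw2 hu
  rw [← he3] at hu
  obtain ⟨hC, w4, hw4, hle4, he4⟩ := exists_le_of_mem_iSup hw3 hu
  obtain ⟨T, hT⟩ := (MultiCircuit.mem_circuitEigenspace_iff.1 hw4).exists_isBalancedBy
  exact ⟨(C, T), (lam', w4), hlam', hC, hT, hle4.trans (hle3.trans (hle2.trans hle1)),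
    he4.trans (he3.trans (he2.trans he1))⟩

theorem tendsto_of_mem_rmaxBall {l : Filter ℝ} (hl : l ≤ 𝓝[>] (0 : ℝ)) {lam : RMax} {f : ℝ → RMax}
    (hf : ∀ᶠ delta in l, f delta ∈ rmaxBall lam (n * delta)) : Tendsto f l (𝓝 lam) := by
  obtain rfl | ⟨r, rfl⟩ := RMax.eq_zero_or_ofReal lam
  · refine tendsto_const_nhds.congr' (hf.mono fun delta h => ?_)
    rcases h with ⟨-, h⟩ | ⟨r, s, h, -⟩
    · exact h.symm
    · exact absurd h.symm (RMax.ofReal_ne_zero r)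
  · have hl0 : Tendsto (fun delta : ℝ => n * delta) l (𝓝 0) := by
      have : Tendsto (fun delta : ℝ => n * delta) (𝓝 0) (𝓝 (n * 0)) :=
        (continuous_const_mul (n : ℝ)).tendsto 0
      rw [mul_zero] at this
      exact this.mono_left (hl.trans nhdsWithin_le_nhds)
    have h1 : Tendsto (fun delta : ℝ => RMax.ofReal (r - n * delta)) l (𝓝 (RMax.ofReal r)) := by
      refine (RMax.continuous_ofReal.tendsto r).comp ?_
      simpa using hl0.const_sub r
    have h2 : Tendsto (fun delta : ℝ => RMax.ofReal (r + n * delta)) l (𝓝 (RMax.ofReal r)) := by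
      refine (RMax.continuous_ofReal.tendsto r).comp ?_
      simpa using hl0.const_add r
    have key : ∀ᶠ delta in l, RMax.ofReal (r - n * delta) ≤ f delta ∧
        f delta ≤ RMax.ofReal (r + n * delta) := by
      refine hf.mono fun delta h => ?_
      rcases h with ⟨h, -⟩ | ⟨r', s, h, hs, h3, h4⟩
      · exact absurd h (RMax.ofReal_ne_zero r)
      · rw [RMax.ofReal_inj] at h
        subst h
        rw [hs]
        exact ⟨RMax.ofReal_le.2 h3, RMax.ofReal_le.2 h4⟩
    exact tendsto_of_tendsto_of_tendsto_of_le_of_le' h1 h2 (key.mono fun _ h => h.1)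
      (key.mono fun _ h => h.2)

theorem tendsto_perturb {l : Filter ℝ} (hl : l ≤ 𝓝[>] (0 : ℝ)) (A : MPMatrix n)
    (zeta : Matrix (Fin n) (Fin n) ℝ) (i j : Fin n) :
    Tendsto (fun delta => perturb A zeta delta i j) l (𝓝 (A i j)) := by
  have h : Continuous fun delta : ℝ => A i j * RMax.ofReal (-(zeta i j * delta)) :=
    (RMax.continuous_const_mul (A i j)).comp
      (RMax.continuous_ofReal.comp (continuous_const.mul continuous_id).neg)
  have h0 := h.tendsto 0
  rw [mul_zero, neg_zero, RMax.ofReal_zero, mul_one] at h0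
  exact h0.mono_left (hl.trans nhdsWithin_le_nhds)

theorem tendsto_termWt {l : Filter ℝ} {B : ℝ → MPMatrix n} {A : MPMatrix n} {f : ℝ → RMax}
    {lam : RMax} (hB : ∀ i j, Tendsto (fun d => B d i j) l (𝓝 (A i j)))
    (hf : Tendsto f l (𝓝 lam)) (i : Fin n) (t : Option (Fin n)) :
    Tendsto (fun d => termWt (B d) (f d) i t) l (𝓝 (termWt A lam i t)) := by
  cases t with
  | none => exact hf
  | some j => exact hB i j

theorem tendsto_termVal {l : Filter ℝ} {B : ℝ → MPMatrix n} {A : MPMatrix n} {f : ℝ → RMax}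
    {lam : RMax} {y : ℝ → MPVec n} {x : MPVec n}
    (hB : ∀ i j, Tendsto (fun d => B d i j) l (𝓝 (A i j)))
    (hf : Tendsto f l (𝓝 lam)) (hy : ∀ j, Tendsto (fun d => y d j) l (𝓝 (x j)))
    (i : Fin n) (t : Option (Fin n)) :
    Tendsto (fun d => termVal (B d) (f d) (y d) i t) l (𝓝 (termVal A lam x i t)) :=
  (tendsto_termWt hB hf i t).mul (hy _)

/-- An upper bound suffices, because the intervals [ε, b] are compact. -/
theorem exists_tendsto_of_le {U : Ultrafilter ℝ} {f g : ℝ → RMax} {a : RMax}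
    (hg : Tendsto g U (𝓝 a)) (hfg : ∀ᶠ d in U, f d ≤ g d) : ∃ b, Tendsto f U (𝓝 b) := by
  obtain ⟨b, hb⟩ : ∃ b, a < b := by
    obtain rfl | ⟨r, rfl⟩ := RMax.eq_zero_or_ofReal a
    · exact ⟨1, zero_lt_one⟩
    · exact ⟨RMax.ofReal (r + 1), RMax.ofReal_lt.2 (lt_add_one r)⟩
  have h : ∀ᶠ d in U, f d ∈ Set.Icc 0 b :=
    (hfg.and (hg.eventually_le_const hb)).mono fun d h => ⟨zero_le, h.1.trans h.2⟩
  obtain ⟨c, -, hc⟩ := (RMax.isCompact_Icc 0 b).ultrafilter_le_nhds (U.map f)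
    (le_principal_iff.2 h)
  exact ⟨c, hc⟩

/-- A limit of vectors in the perturbed sums is, in each coordinate where it is finite, attained by
a limit of balanced vectors for one multi-circuit and one choice of balancing terms. -/
theorem exists_balanced_limit {A : MPMatrix n} {lam : RMax} {zeta : Matrix (Fin n) (Fin n) ℝ}
    {U : Ultrafilter ℝ} (hU : (U : Filter ℝ) ≤ 𝓝[>] (0 : ℝ)) {x : MPVec n}
    (hx : x ∈ limSubspace (perturbedSum A lam zeta)) {u : Fin n} (hu : x u ≠ 0) :
    ∃ (C : MultiCircuit n) (T : Fin n → Option (Fin n)) (x' : MPVec n),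
      C.IsBalancedBy A lam x' T ∧ x' ≤ x ∧ x' u = x u ∧
      (∀ r, lam = RMax.ofReal r → C.IsMaximalReal A r) ∧
      ∀ᶠ delta in U, ∃ lam' y, lam' ∈ rmaxBall lam (n * delta) ∧
        C.IsMaximal (perturb A zeta delta) lam' ∧
        C.IsBalancedBy (perturb A zeta delta) lam' y T ∧ y u ≠ 0 := by
  obtain ⟨y, hy, hlim⟩ := hx
  rw [tendsto_pi_nhds] at hlim
  have hlim' : ∀ j, Tendsto (fun d => y d j) U (𝓝 (x j)) := fun j => (hlim j).mono_left hU
  have hne : ∀ᶠ d in U, y d u ≠ 0 := (hlim' u).eventually_ne hu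
  have hpos : ∀ᶠ d in (U : Filter ℝ), 0 < d := hU eventually_mem_nhdsWithin
  have hex := (hne.and hpos).mono fun d hd => exists_of_mem_perturbedSum (hy d hd.2) hd.1
  -- There are finitely many pairs (C, T), so a single pair works for almost all `delta`.
  rw [Ultrafilter.eventually_exists_iff] at hex
  obtain ⟨⟨C, T⟩, hex⟩ := hex
  obtain ⟨q, hq⟩ := hex.choice
  choose x' hx' using fun j => exists_tendsto_of_le (hlim' j) (hq.mono fun d h => h.2.2.2.1 j)
  have hlam : Tendsto (fun d => (q d).1) U (𝓝 lam) :=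
    tendsto_of_mem_rmaxBall hU (hq.mono fun d h => h.1)
  have hval := tendsto_termVal (tendsto_perturb hU A zeta) hlam hx'
  have hB : ∀ᶠ d in U, C.IsBalancedBy (perturb A zeta d) (q d).1 (q d).2 T :=
    hq.mono fun d h => h.2.2.1
  refine ⟨C, T, x', fun i => ⟨?_, fun t => ?_, ?_⟩, fun j => ?_, ?_, ?_, ?_⟩
  · obtain ⟨d, hd⟩ := hB.exists
    exact (hd i).1
  · exact le_of_tendsto_of_tendsto (hval i t) (hval i _) (hB.mono fun d h => (h i).2.1 t)
  · exact tendsto_nhds_unique_of_eventuallyEq (hval i _) (hval i _)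
      (hB.mono fun d h => (h i).2.2)
  · exact le_of_tendsto_of_tendsto (hx' j) (hlim' j) (hq.mono fun d h => h.2.2.2.1 j)
  · exact tendsto_nhds_unique_of_eventuallyEq (hx' u) (hlim' u)
      (hq.mono fun d h => h.2.2.2.2)
  · rintro r rfl
    -- Total weights converge, so the inequalities expressing maximality pass to the limit.
    rw [MultiCircuit.isMaximalReal_iff]
    intro C'
    have hwt : ∀ C : MultiCircuit n, Tendsto
        (fun d => C.totalWt (perturb A zeta d) (q d).1) U (𝓝 (C.totalWt A (RMax.ofReal r))) :=
      fun C => tendsto_finsetProd _ fun i _ =>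
        tendsto_termWt (tendsto_perturb hU A zeta) hlam i _
    refine le_of_tendsto_of_tendsto (hwt C') (hwt C) (hq.mono fun d h => ?_)
    rcases h.1 with ⟨h0, -⟩ | ⟨r', s, -, hs, -⟩
    · exact absurd h0 (RMax.ofReal_ne_zero r)
    · have := h.2.1.1 s hs
      beta_reduce
      rw [hs]
      exact MultiCircuit.isMaximalReal_iff.1 this C'
  · refine (hq.and hne).mono fun d h => ⟨(q d).1, (q d).2, h.1.1, h.1.2.1, h.1.2.2.1, ?_⟩
    rw [h.1.2.2.2.2]
    exact h.2

end Limits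

/-! ### Saturated cycles are critical circuits of B -/

section Critical

variable {n : ℕ}

namespace MultiCircuit

theorem on_apply (A : MPMatrix n) (lam : RMax) (C : MultiCircuit n) (i j : Fin n) :
    (matOn A C + lam • unitOff C) i j = if j = C.next i then termWt A lam i (C.term i) else 0 := by
  by_cases hi : i ∈ C.verts
  · rw [term_of_mem hi]
    by_cases hj : j = C.next i <;> simp [matOn, unitOff, edges, hi, hj]
  · rw [term_of_notMem hi, C.next_eq i hi]
    by_cases hj : j = i
    · simp [matOn, unitOff, edges, hi, hj]
    · simp [matOn, unitOff, edges, hi, hj, Ne.symm hj]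

/-- The matrix is monomial: the only finite entry of row i is in column `C.next i`. -/
theorem inverse_on {A : MPMatrix n} {lam : RMax} {C : MultiCircuit n}
    (hwt : ∀ i, termWt A lam i (C.term i) ≠ 0) :
    Ring.inverse (matOn A C + lam • unitOff C) =
      Matrix.of fun v i => if v = C.next i then (termWt A lam i (C.term i))⁻¹ else 0 := by
  set P := matOn A C + lam • unitOff C with hP
  set Q : MPMatrix n :=
    Matrix.of fun v i => if v = C.next i then (termWt A lam i (C.term i))⁻¹ else 0 with hQ
  have h1 : P * Q = 1 := by
    ext i k
    rw [Matrix.mul_apply, Finset.sum_eq_single (C.next i)]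
    · rw [hP, on_apply, if_pos rfl, hQ, Matrix.of_apply]
      by_cases hik : i = k
      · subst hik
        rw [if_pos rfl, mul_inv_cancel₀ (hwt i), Matrix.one_apply_eq]
      · rw [if_neg fun h => hik (C.next.injective h), mul_zero, Matrix.one_apply_ne hik]
    · intro j _ hj
      rw [hP, on_apply, if_neg hj, zero_mul]
    · simp
  have h2 : Q * P = 1 := by
    ext v j
    rw [Matrix.mul_apply, Finset.sum_eq_single (C.next.symm v)]
    · rw [hP, on_apply, hQ, Matrix.of_apply, if_pos (by simp)]
      by_cases hvj : v = j
      · subst hvj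
        rw [if_pos (by simp), inv_mul_cancel₀ (hwt _), Matrix.one_apply_eq]
      · rw [if_neg (by simpa using Ne.symm hvj), mul_zero, Matrix.one_apply_ne hvj]
    · intro i _ hi
      rw [hQ, Matrix.of_apply, if_neg fun h => hi (by rw [h, Equiv.symm_apply_apply]), zero_mul]
    · simp
  exact Ring.inverse_unit (⟨P, Q, h1, h2⟩ : (MPMatrix n)ˣ)

theorem matB_apply {A : MPMatrix n} {lam : RMax} {C : MultiCircuit n}
    (hwt : ∀ i, termWt A lam i (C.term i) ≠ 0) (i j : Fin n) :
    matB A lam C (C.next i) j =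
      (termWt A lam i (C.term i))⁻¹ * (matOff A C + lam • unitOn C) i j := by
  rw [matB, inverse_on hwt, Matrix.mul_apply, Finset.sum_eq_single i]
  · rw [Matrix.of_apply, if_pos rfl]
  · intro k _ hk
    rw [Matrix.of_apply, if_neg fun h => hk (C.next.injective h).symm, zero_mul]
  · simp

theorem matB_mulVec {A : MPMatrix n} {lam : RMax} {C : MultiCircuit n}
    (hwt : ∀ i, termWt A lam i (C.term i) ≠ 0) (x : MPVec n) (i : Fin n) :
    (matB A lam C).mulVec x (C.next i) = (termWt A lam i (C.term i))⁻¹ *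
      ∑ t, if t = C.term i then 0 else termVal A lam x i t := by
  rw [← mulVec_off]
  simp only [Matrix.mulVec, dotProduct, matB_apply hwt, mul_assoc, Finset.mul_sum]

/-- Only an inequality, since the entry in column i may combine `A i i` with `lam`. -/
theorem le_off_apply (A : MPMatrix n) (lam : RMax) {C : MultiCircuit n} {i : Fin n}
    {t : Option (Fin n)} (ht : t ≠ C.term i) :
    termWt A lam i t ≤ (matOff A C + lam • unitOn C) i (termCol i t) := by
  rcases t with _ | j
  · have hi : i ∈ C.verts := by
      by_contra hi
      exact ht (term_of_notMem hi).symm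
    refine RMax.le_add_iff.2 (Or.inr ?_)
    simp [unitOn, hi]
  · refine RMax.le_add_iff.2 (Or.inl ?_)
    have : (i, j) ∉ C.edges := by
      rintro ⟨hi, hj⟩
      refine ht ?_
      rw [term_of_mem hi]
      exact congrArg some hj
    simp [matOff, this]

section

variable {A : MPMatrix n} {r : ℝ} {C : MultiCircuit n} {x : MPVec n}

theorem IsBalanced.matB_mulVec_eq {lam : RMax} (hwt : ∀ i, termWt A lam i (C.term i) ≠ 0)
    (hx : C.IsBalanced A lam x) : (matB A lam C).mulVec x = x := by
  funext v
  obtain ⟨i, rfl⟩ := C.next.surjective v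
  have h := congrFun (mem_circuitEigenspace_iff.2 hx : _ = _) i
  rw [mulVec_off, mulVec_on] at h
  rw [matB_mulVec hwt, h, termVal, termCol_term, inv_mul_cancel_left₀ (hwt i)]

theorem IsBalanced.matB_mul_eq {lam : RMax} (hwt : ∀ i, termWt A lam i (C.term i) ≠ 0)
    (hx : C.IsBalanced A lam x) {i : Fin n} {t : Option (Fin n)} (ht : t ≠ C.term i)
    (he : termVal A lam x i t = termVal A lam x i (C.term i)) :
    matB A lam C (C.next i) (termCol i t) * x (termCol i t) = x (C.next i) := by
  refine le_antisymm ?_ ?_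
  · conv_rhs => rw [← hx.matB_mulVec_eq hwt]
    exact RMax.le_sum (f := fun j => matB A lam C (C.next i) j * x j) (Finset.mem_univ _)
  · have h1 : x (C.next i) = (termWt A lam i (C.term i))⁻¹ * termVal A lam x i t := by
      rw [he, termVal, termCol_term, inv_mul_cancel_left₀ (hwt i)]
    rw [h1, matB_apply hwt, termVal, mul_assoc]
    exact mul_le_mul_right (mul_le_mul_left (le_off_apply A lam ht) _) _

/-- For an eigenvalue `mu` above `1` (the real number 0), every row has a term worth `mu` times that
of C at the eigenvector. Switching along a cycle of such terms would multiply the maximal weight by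
a positive power of `mu`. -/
theorem IsMaximalReal.eigenvalue_le_one (hC : C.IsMaximalReal A r) {mu : RMax}
    (hmu : IsMPEigenvalue (matB A (RMax.ofReal r) C) mu) : mu ≤ 1 := by
  obtain ⟨x, hx0, hx⟩ := hmu
  by_contra hlt
  rw [not_le] at hlt
  have hmu0 : mu ≠ 0 := (zero_lt_one.trans hlt).ne'
  have hT : ∀ i, ∃ t, termVal A (RMax.ofReal r) x i t =
      mu * termVal A (RMax.ofReal r) x i (C.term i) := by
    intro i
    have h1 := congrFun hx (C.next i)
    rw [matB_mulVec hC.termWt_ne_zero, Pi.smul_apply, smul_eq_mul,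
      inv_mul_eq_iff_eq_mul₀ (hC.termWt_ne_zero i)] at h1
    have h2 : termWt A (RMax.ofReal r) i (C.term i) * (mu * x (C.next i)) =
        mu * termVal A (RMax.ofReal r) x i (C.term i) := by
      rw [termVal, termCol_term]
      ring
    rw [h2] at h1
    obtain ⟨t, -, ht⟩ := RMax.exists_mem_sum_eq Finset.univ_nonempty
      fun t => if t = C.term i then 0 else termVal A (RMax.ofReal r) x i t
    rw [h1] at ht
    split_ifs at ht with h
    · exact ⟨t, by rw [h, ht, (mul_eq_zero.1 ht).resolve_left hmu0]⟩
    · exact ⟨t, ht.symm⟩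
  choose T hT using hT
  obtain ⟨u, hu⟩ := Function.ne_iff.1 hx0
  have hsucc : ∀ v, x v ≠ 0 → x (C.succ T v) ≠ 0 := by
    intro v hv
    obtain ⟨i, rfl⟩ := C.next.surjective v
    rw [succ_next]
    have h := hT i
    intro h0
    rw [termVal, h0, mul_zero, termVal, termCol_term] at h
    exact mul_ne_zero hmu0 (mul_ne_zero (hC.termWt_ne_zero i) hv) h.symm
  obtain ⟨w, hw, hper⟩ := exists_periodic_mem_fwdOrbit (C.succ T) u
  have hxw : x w ≠ 0 := fwdOrbit_induction (p := fun v => x v ≠ 0) hu hsucc hw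
  have hsw := totalWt_switch (A := A) (lam := RMax.ofReal r) (x := x) (c := mu) hper
    (fun j hj => fwdOrbit_induction (p := fun v => x v ≠ 0) hxw hsucc hj)
    (fun i _ => hC.termWt_ne_zero i) (fun i _ => hT i)
  have hle := isMaximalReal_iff.1 hC (C.switch T w hper)
  have hpos : 0 < C.totalWt A (RMax.ofReal r) :=
    zero_lt_iff.2 (Finset.prod_ne_zero_iff.2 fun i _ => hC.termWt_ne_zero i)
  rw [hsw] at hle
  refine absurd hle (not_le.2 ?_)
  have h1 : 1 < mu ^ (Finset.univ.filter fun i => C.next i ∈ fwdOrbit (C.succ T) w).card := by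
    refine one_lt_pow₀ hlt ?_
    rw [card_filter_next_mem]
    exact Finset.card_ne_zero_of_mem (self_mem_fwdOrbit _ w)
  simpa using mul_lt_mul_of_pos_right h1 hpos

theorem IsBalanced.succ_ne_zero {lam : RMax} {T : Fin n → Option (Fin n)} {v : Fin n}
    (hwt : ∀ i, termWt A lam i (C.term i) ≠ 0) (hv : x v ≠ 0)
    (h : termVal A lam x (C.next.symm v) (T (C.next.symm v)) =
      termVal A lam x (C.next.symm v) (C.term (C.next.symm v))) : x (C.succ T v) ≠ 0 := by
  intro h0
  rw [termVal, show termCol _ (T (C.next.symm v)) = C.succ T v from rfl, h0, mul_zero, termVal,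
    termCol_term, Equiv.apply_symm_apply] at h
  exact mul_ne_zero (hwt _) hv h.symm

/-- A periodic orbit of saturated terms is a critical circuit. -/
theorem IsBalanced.exists_isCritical (hC : C.IsMaximalReal A r)
    (hx : C.IsBalanced A (RMax.ofReal r) x) {T : Fin n → Option (Fin n)} {w : Fin n}
    (hw : w ∈ Function.periodicPts (C.succ T)) (hw0 : x w ≠ 0)
    (hT : ∀ i, C.next i ∈ fwdOrbit (C.succ T) w → T i ≠ C.term i ∧
      termVal A (RMax.ofReal r) x i (T i) = termVal A (RMax.ofReal r) x i (C.term i)) :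
    ∃ D : MultiCircuit n, D.IsCritical (matB A (RMax.ofReal r) C) ∧ w ∈ D.verts ∧
      D.next w = C.succ T w := by
  obtain ⟨D, hel, hverts, hnext⟩ := exists_elementary_of_periodic hw
  have hx0 : ∀ v ∈ fwdOrbit (C.succ T) w, x v ≠ 0 := fun v hv =>
    (fwdOrbit_induction (p := fun v => v ∈ fwdOrbit (C.succ T) w ∧ x v ≠ 0)
      ⟨self_mem_fwdOrbit _ w, hw0⟩ (fun v hv => ⟨apply_mem_fwdOrbit hv.1,
        IsBalanced.succ_ne_zero hC.termWt_ne_zero hv.2 (hT _ (by simpa using hv.1)).2⟩) hv).2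
  have hB : ∀ v ∈ fwdOrbit (C.succ T) w,
      matB A (RMax.ofReal r) C v (D.next v) * x (D.next v) = x v := by
    intro v hv
    rw [hnext v hv]
    obtain ⟨i, rfl⟩ := C.next.surjective v
    rw [succ_next]
    exact hx.matB_mul_eq hC.termWt_ne_zero (hT i hv).1 (hT i hv).2
  -- Multiplying the equalities of `hB` round the orbit, the coordinates of x cancel.
  have hweight : D.weight (matB A (RMax.ofReal r) C) = 1 := by
    have h1 := Finset.prod_congr rfl hB
    rw [Finset.prod_mul_distrib] at h1
    have h2 : ∏ v ∈ fwdOrbit (C.succ T) w, x (D.next v) = ∏ v ∈ fwdOrbit (C.succ T) w, x v := by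
      rw [← hverts]
      exact Finset.prod_bijective D.next D.next.bijective
        (fun v => by
          refine ⟨fun hv => (hel.2.1.mapsTo hv), fun hv => ?_⟩
          by_contra hv'
          rw [D.next_eq v hv'] at hv
          exact hv' hv) (fun _ _ => rfl)
    rw [h2] at h1
    rw [weight, hverts]
    exact mul_right_cancel₀ (Finset.prod_ne_zero_iff.2 hx0) (h1.trans (one_mul _).symm)
  refine ⟨D, ⟨hel, weight_ne_zero_iff.1 (by rw [hweight]; exact one_ne_zero), ?_⟩, ?_,
    hnext w (self_mem_fwdOrbit _ w)⟩
  · have h1 : RMax.ofReal (D.avgWeight (matB A (RMax.ofReal r) C)) = 1 := by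
      rw [avgWeight, hweight, RMax.toReal_one, zero_div, RMax.ofReal_zero]
    rw [h1]
    refine ⟨⟨x, fun h => hw0 (by rw [h]; rfl), ?_⟩, fun mu hmu => hC.eigenvalue_le_one hmu⟩
    rw [hx.matB_mulVec_eq hC.termWt_ne_zero, one_smul]
  · rw [hverts]
    exact self_mem_fwdOrbit _ w

/-- Both orbits yield critical circuits through w, which must be one and the same circuit. -/
theorem IsBalanced.succ_eq_of_disjoint (hC : C.IsMaximalReal A r)
    (hdisj : ∀ D D' : MultiCircuit n, D.IsCritical (matB A (RMax.ofReal r) C) →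
      D'.IsCritical (matB A (RMax.ofReal r) C) → D ≠ D' → Disjoint D.verts D'.verts)
    (hx : C.IsBalanced A (RMax.ofReal r) x) {T T' : Fin n → Option (Fin n)} {w : Fin n}
    (hw : w ∈ Function.periodicPts (C.succ T)) (hw' : w ∈ Function.periodicPts (C.succ T'))
    (hw0 : x w ≠ 0)
    (hT : ∀ i, C.next i ∈ fwdOrbit (C.succ T) w → T i ≠ C.term i ∧
      termVal A (RMax.ofReal r) x i (T i) = termVal A (RMax.ofReal r) x i (C.term i))
    (hT' : ∀ i, C.next i ∈ fwdOrbit (C.succ T') w → T' i ≠ C.term i ∧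
      termVal A (RMax.ofReal r) x i (T' i) = termVal A (RMax.ofReal r) x i (C.term i)) :
    C.succ T w = C.succ T' w := by
  obtain ⟨D, hD, hwD, he⟩ := hx.exists_isCritical hC hw hw0 hT
  obtain ⟨D', hD', hwD', he'⟩ := hx.exists_isCritical hC hw' hw0 hT'
  by_cases h : D = D'
  · rw [← he, ← he', h]
  · exact absurd hwD' (Finset.disjoint_left.1 (hdisj D D' hD hD' h) hwD)

end

end MultiCircuit

end Critical

/-! ### Saturated terms in a minimal closed set -/

section SaturatedGraph

variable {n : ℕ}

/-- There is a walk of `m` steps from a point to `w`. -/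
def WalkTo (E : Fin n → Fin n → Prop) (w : Fin n) : ℕ → Fin n → Prop
  | 0, v => v = w
  | m + 1, v => ∃ v', E v v' ∧ WalkTo E w m v'

/-- The points of K that cannot reach w form a closed set missing w, empty by minimality. The rank
is the distance to w. -/
theorem exists_rank {E : Fin n → Fin n → Prop} {K : Finset (Fin n)} {w : Fin n} (hw : w ∈ K)
    (hK : ∀ v ∈ K, ∀ v', E v v' → v' ∈ K)
    (hmin : ∀ U ⊆ K, U.Nonempty → (∀ v ∈ U, ∀ v', E v v' → v' ∈ U) → U = K) :
    ∃ ρ : Fin n → ℕ, ∀ v ∈ K, v ≠ w → ∃ v', E v v' ∧ ρ v' < ρ v := by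
  classical
  have key : ∀ v ∈ K, ∃ m, WalkTo E w m v := by
    by_contra! h
    obtain ⟨v, hv, hvm⟩ := h
    have hU := hmin (K.filter fun v => ∀ m, ¬ WalkTo E w m v) (Finset.filter_subset _ _)
      ⟨v, Finset.mem_filter.2 ⟨hv, hvm⟩⟩ fun u hu u' huu' => by
        rw [Finset.mem_filter] at hu ⊢
        exact ⟨hK u hu.1 u' huu', fun m hm => hu.2 (m + 1) ⟨u', huu', hm⟩⟩
    rw [← hU, Finset.mem_filter] at hw
    exact hw.2 0 rfl
  refine ⟨fun v => sInf {m | WalkTo E w m v}, fun v hv hvw => ?_⟩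
  have hmem : WalkTo E w (sInf {m | WalkTo E w m v}) v := Nat.sInf_mem (key v hv)
  rcases hm : sInf {m | WalkTo E w m v} with _ | m
  · rw [hm] at hmem
    exact absurd hmem hvw
  · rw [hm] at hmem
    obtain ⟨v', hE, hv'⟩ := hmem
    refine ⟨v', hE, ?_⟩
    beta_reduce
    rw [hm]
    exact Nat.lt_succ_of_le (Nat.sInf_le hv')

theorem mem_periodicPts_of_rank {F : Fin n → Fin n} {K : Finset (Fin n)} {w : Fin n} (hw : w ∈ K)
    (hF : ∀ v ∈ K, F v ∈ K) {ρ : Fin n → ℕ} (hρ : ∀ v ∈ K, v ≠ w → ρ (F v) < ρ v) :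
    w ∈ Function.periodicPts F := by
  have key : ∀ m, ∀ v ∈ K, ρ v = m → ∃ k, F^[k] v = w := by
    intro m
    induction m using Nat.strong_induction_on with
    | _ m ih =>
      intro v hv hm
      by_cases hvw : v = w
      · exact ⟨0, hvw⟩
      · obtain ⟨k, hk⟩ := ih _ (hm ▸ hρ v hv hvw) (F v) (hF v hv) rfl
        exact ⟨k + 1, hk⟩
  obtain ⟨k, hk⟩ := key _ (F w) (hF w hw) rfl
  exact ⟨k + 1, k.succ_pos, hk⟩

/-- Only column i holds two terms of row i, namely `none` and `some i`; a third term lies elsewhere.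
-/
theorem termCol_eq_of_ne {i : Fin n} {s t t' : Option (Fin n)} (h : t ≠ t') (ht : t ≠ s)
    (ht' : t' ≠ s) (hcol : termCol i t = termCol i t') :
    termCol i t = i ∧ termCol i s ≠ i := by
  rcases s with _ | j <;> rcases t with _ | k <;> rcases t' with _ | l <;> simp_all <;> grind

namespace MultiCircuit

/-- The set `U` of columns is closed under passing to a saturated term in the row in which `C` uses
the column. -/
def SatClosed (A : MPMatrix n) (lam : RMax) (C : MultiCircuit n) (x : MPVec n)
    (U : Finset (Fin n)) : Prop :=
  ∀ i, C.next i ∈ U → ∀ t, termVal A lam x i t = termVal A lam x i (C.term i) → termCol i t ∈ U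

theorem SatClosed.of_isMaximalReal {A : MPMatrix n} {r : ℝ} {C C' : MultiCircuit n} {x : MPVec n}
    {U : Finset (Fin n)} (hU : C.SatClosed A (RMax.ofReal r) x U)
    (hx : C.IsBalanced A (RMax.ofReal r) x) (hC' : C'.IsMaximalReal A r) :
    C'.SatClosed A (RMax.ofReal r) x U := by
  have h : ∀ i, C.next i ∈ U → C'.next i ∈ U := fun i hi => by
    rw [← termCol_term C']
    exact hU i hi _ (hx.termVal_eq hC' i)
  intro i hi t ht
  exact hU i (next_mem_of_imp h i hi) t (ht.trans (hx.termVal_eq hC' i))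

/-- In a minimal closed set, every saturated term lies on a cycle. -/
theorem SatClosed.exists_cycle {A : MPMatrix n} {lam : RMax} {C : MultiCircuit n} {x : MPVec n}
    {K : Finset (Fin n)} (hK : C.SatClosed A lam x K)
    (hmin : ∀ U ⊆ K, U.Nonempty → C.SatClosed A lam x U → U = K) {i : Fin n} (hi : C.next i ∈ K)
    {t : Option (Fin n)} (ht : t ≠ C.term i)
    (hsat : termVal A lam x i t = termVal A lam x i (C.term i)) :
    ∃ T : Fin n → Option (Fin n), T i = t ∧
      (∀ k, C.next k ∈ K → T k ≠ C.term k ∧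
        termVal A lam x k (T k) = termVal A lam x k (C.term k)) ∧
      C.next i ∈ Function.periodicPts (C.succ T) := by
  classical
  have hclosed : ∀ U : Finset (Fin n), (∀ v ∈ U, ∀ v', (∃ k s, C.next k = v ∧ s ≠ C.term k ∧
      termVal A lam x k s = termVal A lam x k (C.term k) ∧ termCol k s = v') → v' ∈ U) →
      C.SatClosed A lam x U := by
    intro U hU k hk s hs
    by_cases hsC : s = C.term k
    · rw [hsC, termCol_term]
      exact hk
    · exact hU _ hk _ ⟨k, s, rfl, hsC, hs, rfl⟩
  obtain ⟨ρ, hρ⟩ := exists_rank (E := fun v v' => ∃ k s, C.next k = v ∧ s ≠ C.term k ∧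
      termVal A lam x k s = termVal A lam x k (C.term k) ∧ termCol k s = v') hi
    (by
      rintro v hv v' ⟨k, s, rfl, -, hs, rfl⟩
      exact hK k hv s hs)
    fun U hUK hne hU => hmin U hUK hne (hclosed U hU)
  -- T uses t in row i and elsewhere in K moves closer to `C.next i`, so the walk starting with t
  -- must return.
  have hT : ∀ k, ∃ s, (k = i → s = t) ∧ (C.next k ∈ K → s ≠ C.term k ∧
      termVal A lam x k s = termVal A lam x k (C.term k)) ∧
      (C.next k ∈ K → C.next k ≠ C.next i → ρ (termCol k s) < ρ (C.next k)) := by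
    intro k
    by_cases hki : k = i
    · subst hki
      exact ⟨t, fun _ => rfl, fun _ => ⟨ht, hsat⟩, fun _ h => absurd rfl h⟩
    by_cases hk : C.next k ∈ K
    · obtain ⟨_, ⟨k', s, hk', h1, h2, rfl⟩, h3⟩ := hρ _ hk fun h => hki (C.next.injective h)
      obtain rfl := C.next.injective hk'
      exact ⟨s, fun h => absurd h hki, fun _ => ⟨h1, h2⟩, fun _ _ => h3⟩
    · exact ⟨none, fun h => absurd h hki, fun h => absurd h hk, fun h => absurd h hk⟩
  choose T hT1 hT2 hT3 using hT
  refine ⟨T, hT1 i rfl, hT2, mem_periodicPts_of_rank (ρ := ρ) hi ?_ ?_⟩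
  · intro v hv
    obtain ⟨k, rfl⟩ := C.next.surjective v
    rw [succ_next]
    exact hK k hv _ (hT2 k hv).2
  · intro v hv hne
    obtain ⟨k, rfl⟩ := C.next.surjective v
    rw [succ_next]
    exact hT3 k hv hne

theorem fwdOrbit_succ_subset {A : MPMatrix n} {lam : RMax} {C : MultiCircuit n} {x : MPVec n}
    {K : Finset (Fin n)} {T : Fin n → Option (Fin n)} (hK : C.SatClosed A lam x K)
    (hT : ∀ k, C.next k ∈ K → termVal A lam x k (T k) = termVal A lam x k (C.term k))
    {w : Fin n} (hw : w ∈ K) : fwdOrbit (C.succ T) w ⊆ K := fun _ hv =>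
  fwdOrbit_induction (p := (· ∈ K)) hw (fun v hv => by
    obtain ⟨k, rfl⟩ := C.next.surjective v
    rw [succ_next]
    exact hK k hv _ (hT k hv)) hv

theorem isMaximalReal_switch {A : MPMatrix n} {r : ℝ} {C : MultiCircuit n} {x : MPVec n}
    {T : Fin n → Option (Fin n)} {w : Fin n} (hC : C.IsMaximalReal A r)
    (hw : w ∈ Function.periodicPts (C.succ T)) (hx : ∀ v ∈ fwdOrbit (C.succ T) w, x v ≠ 0)
    (hT : ∀ i, C.next i ∈ fwdOrbit (C.succ T) w →
      termVal A (RMax.ofReal r) x i (T i) = termVal A (RMax.ofReal r) x i (C.term i)) :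
    (C.switch T w hw).IsMaximalReal A r := by
  rw [isMaximalReal_iff, totalWt_switch (c := 1) hw hx (fun i _ => hC.termWt_ne_zero i)
    (fun i hi => by rw [hT i hi, one_mul]), one_pow, one_mul]
  exact isMaximalReal_iff.1 hC

theorem next_switch_mem_iff {C : MultiCircuit n} {T : Fin n → Option (Fin n)} {w : Fin n}
    (hw : w ∈ Function.periodicPts (C.succ T)) (i : Fin n) :
    (C.switch T w hw).next i ∈ fwdOrbit (C.succ T) w ↔ C.next i ∈ fwdOrbit (C.succ T) w := by
  have h : ∀ i, C.next i ∈ fwdOrbit (C.succ T) w →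
      (C.switch T w hw).next i ∈ fwdOrbit (C.succ T) w := fun i hi => by
    rw [← termCol_term, term_switch, if_pos hi]
    exact mapsTo_fwdOrbit_succ C T w i hi
  exact ⟨next_mem_of_imp h i, h i⟩

/-- If critical circuits are disjoint, then a row in which `C` uses a column of a cycle of saturated
terms inside a minimal closed set has no saturated terms but that of `C` and that of the cycle. -/
theorem eq_of_saturated {A : MPMatrix n} {r : ℝ} {C : MultiCircuit n} {x : MPVec n}
    (hdisj : ∀ C : MultiCircuit n, C.IsMaximalReal A r → ∀ D D' : MultiCircuit n,
      D.IsCritical (matB A (RMax.ofReal r) C) →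
      D'.IsCritical (matB A (RMax.ofReal r) C) → D ≠ D' → Disjoint D.verts D'.verts)
    (hC : C.IsMaximalReal A r) (hx : C.IsBalanced A (RMax.ofReal r) x)
    {K : Finset (Fin n)} (hK : C.SatClosed A (RMax.ofReal r) x K) (hK0 : ∀ v ∈ K, x v ≠ 0)
    (hmin : ∀ U ⊆ K, U.Nonempty → C.SatClosed A (RMax.ofReal r) x U → U = K)
    {T : Fin n → Option (Fin n)} {w : Fin n} (hw : w ∈ Function.periodicPts (C.succ T))
    (hwK : fwdOrbit (C.succ T) w ⊆ K)
    (hT : ∀ i, C.next i ∈ fwdOrbit (C.succ T) w → T i ≠ C.term i ∧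
      termVal A (RMax.ofReal r) x i (T i) = termVal A (RMax.ofReal r) x i (C.term i))
    {i : Fin n} (hi : C.next i ∈ fwdOrbit (C.succ T) w) {t : Option (Fin n)}
    (hsat : termVal A (RMax.ofReal r) x i t = termVal A (RMax.ofReal r) x i (C.term i)) :
    t = C.term i ∨ t = T i := by
  by_contra! hne
  -- A saturated t lies on a cycle of its own, which by disjointness leaves `C.next i` to the same
  -- column as the cycle of T.
  have hcol : termCol i t = termCol i (T i) := by
    obtain ⟨T', hT'i, hT', hper'⟩ := hK.exists_cycle hmin (hwK hi) hne.1 hsat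
    have hper : C.next i ∈ Function.periodicPts (C.succ T) := by
      obtain ⟨p, hp, h⟩ := hw
      exact ⟨p, hp, isPeriodicPt_of_mem_fwdOrbit h hi⟩
    have h := hx.succ_eq_of_disjoint hC (hdisj C hC) hper' hper (hK0 _ (hwK hi))
      (fun k hk => hT' k (fwdOrbit_succ_subset hK (fun k hk => (hT' k hk).2) (hwK hi) hk))
      (fun k hk => hT k (fwdOrbit_subset hi hk))
    rwa [succ_next, succ_next, hT'i] at h
  have hTi := (hT i hi).1
  -- What remains is the pair of terms in column i, which B cannot tell apart for C. After switching
  -- to T they become visible: the switched multi-circuit uses column i in row i, so t gives a loop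
  -- at i, while the old terms of C give the reversed cycle through i. Both are critical, and they
  -- differ because `C.next i ≠ i`.
  have hcol' : termCol i (T i) = i ∧ termCol i t = i ∧ C.next i ≠ i := by
    have h := termCol_eq_of_ne hne.2 hne.1 hTi hcol
    rw [termCol_term] at h
    exact ⟨hcol ▸ h.1, h⟩
  have hmaxs := isMaximalReal_switch hC hw (fun v hv => hK0 v (hwK hv)) fun i hi => (hT i hi).2
  have hxs := hx.of_isMaximalReal hmaxs
  have hterm : ∀ k, C.next k ∈ fwdOrbit (C.succ T) w → (C.switch T w hw).term k = T k :=
    fun k hk => by rw [term_switch, if_pos hk]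
  have hnexti : (C.switch T w hw).next i = i := by
    rw [← termCol_term, hterm i hi, hcol'.1]
  have hiD : i ∈ fwdOrbit (C.succ T) w := by
    rw [← hnexti]
    exact (next_switch_mem_iff hw i).2 hi
  set C' := C.switch T w hw with hC'
  have hsucc1 : C'.succ (fun _ => t) i = i := by
    conv_lhs => rw [← hnexti]
    rw [succ_next, hcol'.2.1]
  have hsucc2 : ∀ k, C'.succ C.term (C'.next k) = C.next k := fun k => by
    rw [succ_next, termCol_term]
  have hinj : Function.Injective (C'.succ C.term) := by
    intro a b hab
    obtain ⟨k, rfl⟩ := C'.next.surjective a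
    obtain ⟨l, rfl⟩ := C'.next.surjective b
    rw [hsucc2, hsucc2] at hab
    rw [C.next.injective hab]
  have horb1 : ∀ v ∈ fwdOrbit (C'.succ fun _ => t) i, v = i := fun v hv =>
    fwdOrbit_induction (p := fun v => v = i) rfl (fun v hv => by rw [hv, hsucc1]) hv
  have horb2 : ∀ v ∈ fwdOrbit (C'.succ C.term) i, v ∈ fwdOrbit (C.succ T) w := fun v hv =>
    fwdOrbit_induction (p := fun v => v ∈ fwdOrbit (C.succ T) w) hiD (fun v hv => by
      obtain ⟨k, rfl⟩ := C'.next.surjective v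
      rw [hsucc2]
      exact (next_switch_mem_iff hw k).1 hv) hv
  have h := hxs.succ_eq_of_disjoint hmaxs (hdisj C' hmaxs)
    (T := fun _ => t) (T' := C.term) (w := i)
    ⟨1, one_pos, hsucc1⟩ (hinj.mem_periodicPts i) (hK0 i (hwK hiD))
    (fun k hk => by
      obtain rfl : k = i := C'.next.injective ((horb1 _ hk).trans hnexti.symm)
      rw [hterm k hi]
      exact ⟨hne.2, hsat.trans (hT k hi).2.symm⟩)
    (fun k hk => by
      have hk' := (next_switch_mem_iff hw k).1 (horb2 _ hk)
      rw [hterm k hk']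
      exact ⟨(hT k hk').1.symm, (hT k hk').2.symm⟩)
  rw [hsucc1] at h
  have h2 := hsucc2 i
  rw [hnexti, ← h] at h2
  exact hcol'.2.2 h2.symm

end MultiCircuit

end SaturatedGraph

/-! ### Covering by other eigenspaces: real eigenvalues -/

section Covers

variable {n : ℕ}

/-- In every row of `A ⊕ mu ⊗ E`, the maximum of the terms at `y` is attained twice. -/
def IsDoublyAttained (A : MPMatrix n) (mu : RMax) (y : MPVec n) : Prop :=
  ∀ i, ∃ t t', t ≠ t' ∧ (∀ s, termVal A mu y i s ≤ termVal A mu y i t) ∧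
    termVal A mu y i t' = termVal A mu y i t

theorem MultiCircuit.IsBalancedBy.isDoublyAttained {A : MPMatrix n} {mu : RMax}
    {C : MultiCircuit n} {y : MPVec n} {T : Fin n → Option (Fin n)}
    (h : C.IsBalancedBy A mu y T) : IsDoublyAttained A mu y :=
  fun i => ⟨C.term i, T i, (h i).1.symm, (h i).2.1, (h i).2.2⟩

theorem IsDoublyAttained.exists_ne {A : MPMatrix n} {mu : RMax} {y : MPVec n}
    (h : IsDoublyAttained A mu y) (i : Fin n) (s : Option (Fin n)) :
    ∃ t, t ≠ s ∧ ∀ s', termVal A mu y i s' ≤ termVal A mu y i t := by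
  obtain ⟨t, t', hne, hle, he⟩ := h i
  by_cases hs : t = s
  · exact ⟨t', fun h => hne (hs.trans h.symm), fun s' => he.symm ▸ hle s'⟩
  · exact ⟨t, hs, hle⟩

/-- For the smaller `mu` the diagonal term at y is strictly below the row maximum, so the second
maximal term is an entry of A. As y ≤ x, its value is squeezed to be maximal at x as well. -/
theorem IsDoublyAttained.exists_saturated {A : MPMatrix n} {lam mu : RMax} (hmu : mu < lam)
    {x y : MPVec n} (hy : IsDoublyAttained A mu y) (hyx : y ≤ x) {i j : Fin n}
    (hxj : A i j * x j ≠ 0)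
    (hmax : ∀ t, termVal A lam x i t ≤ A i j * x j) (hj : y j = x j) :
    ∃ k, k ≠ j ∧ A i k * x k = A i j * x j ∧ y k = x k := by
  obtain ⟨t, ht, hle⟩ := hy.exists_ne i (some j)
  have h1 := hle (some j)
  rw [termVal_some, hj] at h1
  rcases t with _ | k
  · exfalso
    rw [termVal_none] at h1
    have hyi : y i ≠ 0 := fun h0 => by
      rw [h0, mul_zero, le_zero_iff] at h1
      exact hxj h1
    have h2 : mu * y i < lam * y i := mul_lt_mul_of_pos_right hmu (zero_lt_iff.2 hyi)
    have h3 : lam * y i ≤ lam * x i := mul_le_mul_right (hyx i) _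
    exact absurd (h1.trans_lt (h2.trans_le (h3.trans (hmax none)))) (lt_irrefl _)
  · rw [termVal_some] at h1
    have h2 : A i k * x k ≤ A i j * x j := hmax (some k)
    have h3 : A i k * y k ≤ A i k * x k := mul_le_mul_right (hyx k) _
    have hk0 : A i k ≠ 0 := fun h0 => by
      rw [h0, zero_mul, le_zero_iff] at h1
      exact hxj h1
    exact ⟨k, fun h => ht (by rw [h]), le_antisymm h2 (h1.trans h3),
      mul_left_cancel₀ hk0 (le_antisymm h3 (h2.trans h1))⟩

/-- If y agreed with x at i, the diagonal term for the larger `mu` would strictly exceed every other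
term of the row. -/
theorem IsDoublyAttained.apply_ne {A : MPMatrix n} {lam mu : RMax} (hmu : lam < mu)
    {x y : MPVec n} (hy : IsDoublyAttained A mu y) (hyx : y ≤ x) {i : Fin n} (hxi : x i ≠ 0)
    (hmax : ∀ j, A i j * x j ≤ lam * x i) : y i ≠ x i := by
  intro hi
  obtain ⟨t, ht, hle⟩ := hy.exists_ne i none
  have h1 := hle none
  rcases t with _ | j
  · exact ht rfl
  · rw [termVal_none, termVal_some, hi] at h1
    have h2 : A i j * y j ≤ A i j * x j := mul_le_mul_right (hyx j) _
    exact absurd (h1.trans (h2.trans (hmax j)))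
      (not_le.2 (mul_lt_mul_of_pos_right hmu (zero_lt_iff.2 hxi)))

namespace MultiCircuit

theorem sum_next_mem {M : Type*} [AddCommMonoid M] (C : MultiCircuit n) (D : Finset (Fin n))
    (f : Fin n → M) : ∑ i with C.next i ∈ D, f (C.next i) = ∑ v ∈ D, f v :=
  Finset.sum_bij (fun i _ => C.next i) (fun i hi => (Finset.mem_filter.1 hi).2)
    (fun i _ j _ h => C.next.injective h)
    (fun j hj => ⟨C.next.symm j, by simpa using hj, by simp⟩) (fun _ _ => rfl)

theorem sum_termCol_mem {M : Type*} [AddCommMonoid M] {C : MultiCircuit n}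
    {T : Fin n → Option (Fin n)} {w : Fin n} (hw : w ∈ Function.periodicPts (C.succ T))
    (f : Fin n → M) : ∑ i with C.next i ∈ fwdOrbit (C.succ T) w, f (termCol i (T i)) =
      ∑ v ∈ fwdOrbit (C.succ T) w, f v :=
  Finset.sum_bij (fun i _ => termCol i (T i))
    (fun i hi => mapsTo_fwdOrbit_succ C T w i (Finset.mem_filter.1 hi).2)
    (fun i hi j hj h => injOn_fwdOrbit_succ hw (Finset.mem_filter.1 hi).2
      (Finset.mem_filter.1 hj).2 h)
    (fun v hv => by
      obtain ⟨u, hu, rfl⟩ := exists_apply_eq_of_mem_fwdOrbit hw hv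
      exact ⟨C.next.symm u, by simpa using hu, rfl⟩) (fun _ _ => rfl)

theorem length_add_sum (C : MultiCircuit n) :
    C.length + ∑ i, (if C.term i = none then 1 else 0) = n := by
  rw [length_eq_card, ← Finset.card_filter, add_comm,
    Finset.card_filter_add_card_filter_not, Finset.card_univ, Fintype.card_fin]

/-- A cycle of rows with exactly two saturated terms, on which all columns are attained by vectors
that are doubly attained for other parameters, does not change the length. -/
theorem length_switch_eq {A : MPMatrix n} {lam : RMax} {C : MultiCircuit n} {x : MPVec n}
    (hx : C.IsBalanced A lam x) {T : Fin n → Option (Fin n)} {w : Fin n}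
    (hw : w ∈ Function.periodicPts (C.succ T))
    (hwt : ∀ i, termWt A lam i (C.term i) ≠ 0)
    (hx0 : ∀ v ∈ fwdOrbit (C.succ T) w, x v ≠ 0)
    (hT : ∀ i, C.next i ∈ fwdOrbit (C.succ T) w → T i ≠ C.term i ∧
      termVal A lam x i (T i) = termVal A lam x i (C.term i))
    (huniq : ∀ i, C.next i ∈ fwdOrbit (C.succ T) w → ∀ t,
      termVal A lam x i t = termVal A lam x i (C.term i) → t = C.term i ∨ t = T i)
    (hcover : ∀ v ∈ fwdOrbit (C.succ T) w, ∃ mu, mu ≠ lam ∧ ∃ y, IsDoublyAttained A mu y ∧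
      y ≤ x ∧ y v = x v) :
    (C.switch T w hw).length = C.length := by
  classical
  set D := fwdOrbit (C.succ T) w with hD
  set p : Fin n → Prop := fun v => ∃ mu, mu < lam ∧ ∃ y, IsDoublyAttained A mu y ∧
    y ≤ x ∧ y v = x v with hp
  -- p marks the columns attained for a smaller parameter. Marks change between the two columns of a
  -- row only when one of its two terms is the diagonal `lam`.
  have hrow : ∀ i, C.next i ∈ D →
      (if p (C.next i) then 1 else 0) + (if T i = none then 1 else 0) =
        (if p (termCol i (T i)) then 1 else 0) + (if C.term i = none then 1 else 0) := by
    intro i hi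
    obtain ⟨hne, hsat⟩ := hT i hi
    have hmax := (hx i).1
    have hun := huniq i hi
    have hM : termVal A lam x i (C.term i) ≠ 0 := by
      rw [termVal, termCol_term]
      exact mul_ne_zero (hwt i) (hx0 _ hi)
    have hTi : termCol i (T i) ∈ D := mapsTo_fwdOrbit_succ C T w i hi
    rw [← termCol_term C i] at hi ⊢
    have hdiag : i ∈ D → lam * x i = termVal A lam x i (C.term i) → p i := by
      intro hiD hs
      obtain ⟨mu, hmu, y, hy, hyx, he⟩ := hcover i hiD
      rcases lt_or_gt_of_ne hmu with h | h
      · exact ⟨mu, h, y, hy, hyx, he⟩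
      · exact absurd he (hy.apply_ne h hyx (hx0 i hiD) fun j => hs ▸ hmax (some j))
    have hstep : ∀ j, A i j * x j = termVal A lam x i (C.term i) → p j →
        ∃ k, k ≠ j ∧ A i k * x k = termVal A lam x i (C.term i) ∧ p k := by
      rintro j hj ⟨mu, hmu, y, hy, hyx, he⟩
      obtain ⟨k, hk, hk1, hk2⟩ := hy.exists_saturated hmu hyx (hj ▸ hM) (fun t => hj ▸ hmax t) he
      exact ⟨k, hk, hk1.trans hj, mu, hmu, y, hy, hyx, hk2⟩
    rcases hCi : C.term i with _ | j <;> rcases hTi' : T i with _ | k <;>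
      simp only [hCi, hTi', termCol_none, termCol_some, termVal_none, termVal_some] at *
    · have h1 : p i := hdiag hi trivial
      -- A mark on k would produce a saturated entry of A outside column k, a third saturated term.
      have h2 : ¬ p k := by
        intro hk
        obtain ⟨l, hl, hl1, -⟩ := hstep k hsat hk
        rcases hun (some l) hl1 with h | h
        · exact absurd h (by simp)
        · exact hl (Option.some_injective _ h)
      simp [h1, h2]
    · have h1 : p i := hdiag hTi hsat
      have h2 : ¬ p j := by
        intro hj
        obtain ⟨l, hl, hl1, -⟩ := hstep j rfl hj
        rcases hun (some l) hl1 with h | h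
        · exact hl (Option.some_injective _ h)
        · exact absurd h (by simp)
      simp [h1, h2]
    · have h1 : p j → p k := by
        intro hj
        obtain ⟨l, hl, hl1, hl2⟩ := hstep j rfl hj
        rcases hun (some l) hl1 with h | h
        · exact absurd (Option.some_injective _ h) hl
        · exact Option.some_injective _ h ▸ hl2
      have h2 : p k → p j := by
        intro hk
        obtain ⟨l, hl, hl1, hl2⟩ := hstep k hsat hk
        rcases hun (some l) hl1 with h | h
        · exact Option.some_injective _ h ▸ hl2
        · exact absurd (Option.some_injective _ h) hl
      by_cases hk : p k
      · simp [hk, h2 hk]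
      · simp [hk, mt h1 hk]
  -- Both selections run through each column of D once, so the marks cancel and the counts of
  -- diagonal terms agree.
  have hsum := Finset.sum_congr (rfl : (Finset.univ.filter fun i => C.next i ∈ D) = _)
    fun i hi => hrow i (Finset.mem_filter.1 hi).2
  rw [Finset.sum_add_distrib, Finset.sum_add_distrib,
    sum_next_mem C D fun v => if p v then 1 else 0,
    sum_termCol_mem hw fun v => if p v then 1 else 0] at hsum
  have hnone := Nat.add_left_cancel hsum
  have h1 := length_add_sum (C.switch T w hw)
  have h2 := length_add_sum C
  rw [← Finset.sum_filter_add_sum_filter_not Finset.univ (fun i => C.next i ∈ D)] at h1 h2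
  have h3 : ∑ i with C.next i ∈ D, (if (C.switch T w hw).term i = none then 1 else 0) =
      ∑ i with C.next i ∈ D, (if T i = none then 1 else 0) :=
    Finset.sum_congr rfl fun i hi => by rw [term_switch, if_pos (Finset.mem_filter.1 hi).2]
  have h4 : ∑ i with ¬ C.next i ∈ D, (if (C.switch T w hw).term i = none then 1 else 0) =
      ∑ i with ¬ C.next i ∈ D, (if C.term i = none then 1 else 0) :=
    Finset.sum_congr rfl fun i hi => by rw [term_switch, if_neg (Finset.mem_filter.1 hi).2]
  rw [h3, h4] at h1
  omega

end MultiCircuit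

theorem mem_of_forall_exists_le {W : Submodule RMax (MPVec n)} {x : MPVec n}
    (h : ∀ u, x u ≠ 0 → ∃ y ∈ W, y ≤ x ∧ y u = x u) : x ∈ W := by
  have h' : ∀ u, ∃ y ∈ W, y ≤ x ∧ y u = x u := by
    intro u
    by_cases hu : x u = 0
    · exact ⟨0, W.zero_mem, fun _ => zero_le, hu.symm⟩
    · exact h u hu
  choose y hyW hyx hyu using h'
  have hx : x = ∑ u, y u := by
    funext v
    rw [Finset.sum_apply]
    refine le_antisymm ?_ (RMax.sum_le_iff.2 fun u _ => hyx u v)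
    rw [← hyu v]
    exact RMax.le_sum (f := fun u => y u v) (Finset.mem_univ v)
  rw [hx]
  exact W.sum_mem fun u _ => hyW u

/-- Different coordinates may come from different maximal multi-circuits in the limit, but being
balanced is the same condition for all of them. -/
theorem isBalanced_of_mem_limSubspace {A : MPMatrix n} {r : ℝ}
    {zeta : Matrix (Fin n) (Fin n) ℝ} {x : MPVec n}
    (hx : x ∈ limSubspace (perturbedSum A (RMax.ofReal r) zeta)) {C : MultiCircuit n}
    (hC : C.IsMaximalReal A r) : C.IsBalanced A (RMax.ofReal r) x := by
  rw [← MultiCircuit.mem_circuitEigenspace_iff]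
  refine mem_of_forall_exists_le fun u hu => ?_
  obtain ⟨C', T, x', hbal, hle, he, hmax, -⟩ :=
    exists_balanced_limit (Ultrafilter.of_le (𝓝[>] (0 : ℝ))) hx hu
  exact ⟨x', MultiCircuit.mem_circuitEigenspace_iff.2 (hbal.isBalanced.of_isMaximalReal hC),
    hle, he⟩

theorem eventually_distinctLengths {A : MPMatrix n} {zeta : Matrix (Fin n) (Fin n) ℝ}
    (hz : zeta ∈ genericDirections A) :
    ∀ᶠ delta in 𝓝[>] (0 : ℝ), DistinctLengths (perturb A zeta delta) := by
  obtain ⟨-, d, hd, h⟩ := hz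
  exact mem_of_superset (Ioo_mem_nhdsGT hd) fun delta hdelta => h delta hdelta.1 hdelta.2

namespace MultiCircuit

section

variable {A : MPMatrix n} {lam : RMax} {C : MultiCircuit n} {x x' z : MPVec n}
  {T : Fin n → Option (Fin n)} {i : Fin n} {t : Option (Fin n)}

theorem IsBalancedBy.termVal_eq_of_le (hT : C.IsBalancedBy A lam x' T) (hx : C.IsBalanced A lam x)
    (hle : x' ≤ x) (he : x' (C.next i) = x (C.next i)) :
    termVal A lam x i (T i) = termVal A lam x i (C.term i) := by
  refine le_antisymm ((hx i).1 _) ?_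
  have h1 : termVal A lam x i (C.term i) = termVal A lam x' i (C.term i) := by
    rw [termVal, termVal, termCol_term, he]
  rw [h1, ← (hT i).2.2]
  exact termVal_mono A _ hle i _

/-- The term of T has the same finite value at x' and at x, so its column has the same coordinate.
Agreement of x' with x thus propagates along T. -/
theorem IsBalancedBy.apply_termCol_eq (hT : C.IsBalancedBy A lam x' T)
    (hx : C.IsBalanced A lam x) (hle : x' ≤ x) (he : x' (C.next i) = x (C.next i))
    (hwt : termWt A lam i (C.term i) ≠ 0) (hxi : x (C.next i) ≠ 0) :
    x' (termCol i (T i)) = x (termCol i (T i)) := by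
  have h1 := hT.termVal_eq_of_le hx hle he
  have h2 : termVal A lam x' i (T i) = termVal A lam x i (T i) := by
    rw [h1, (hT i).2.2, termVal, termVal, termCol_term, he]
  refine mul_left_cancel₀ (fun h0 => ?_) h2
  rw [termVal, h0, zero_mul, termVal, termCol_term] at h1
  exact mul_ne_zero hwt hxi h1.symm

/-- If z reached x in the column of a saturated term, balance of z would lift the term of C to its
full value. So a deficit of z spreads along saturated terms. -/
theorem IsBalanced.apply_termCol_ne (hz : C.IsBalanced A lam z) (hzx : z ≤ x)
    (hwt : termWt A lam i (C.term i) ≠ 0) (hne : z (C.next i) ≠ x (C.next i))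
    (ht : termVal A lam x i t = termVal A lam x i (C.term i)) :
    z (termCol i t) ≠ x (termCol i t) := by
  intro he
  refine hne (le_antisymm (hzx _) ?_)
  have h1 := (hz i).1 t
  rw [termVal, he, ← termVal, ht, termVal, termVal, termCol_term] at h1
  exact le_of_mul_le_mul_left h1 (zero_lt_iff.2 hwt)

end

end MultiCircuit

theorem apply_ne_zero_of_ne {x z : MPVec n} (hzx : z ≤ x) {u : Fin n} (h : z u ≠ x u) : x u ≠ 0 :=
  fun h0 => h (by rw [h0]; exact le_zero_iff.1 (h0 ▸ hzx u))

/-- For real `lam`, a part of a vector of the eigenspace that covers whatever is not covered by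
other eigenspaces is the whole vector. -/
theorem eq_of_cover_ofReal {A : MPMatrix n} {r : ℝ}
    (hdisj : ∀ C : MultiCircuit n, C.IsMaximalReal A r → ∀ D D' : MultiCircuit n,
      D.IsCritical (matB A (RMax.ofReal r) C) →
      D'.IsCritical (matB A (RMax.ofReal r) C) → D ≠ D' → Disjoint D.verts D'.verts)
    {zeta : Matrix (Fin n) (Fin n) ℝ} (hzeta : zeta ∈ genericDirections A) {x z : MPVec n}
    (hx : x ∈ limSubspace (perturbedSum A (RMax.ofReal r) zeta))
    (hz : z ∈ limSubspace (perturbedSum A (RMax.ofReal r) zeta)) (hzx : z ≤ x)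
    (hcover : ∀ u, x u ≠ 0 → z u = x u ∨
      ∃ mu, mu ≠ RMax.ofReal r ∧ ∃ y, IsDoublyAttained A mu y ∧ y ≤ x ∧ y u = x u) : z = x := by
  classical
  by_contra hne
  set U : Ultrafilter ℝ := Ultrafilter.of (𝓝[>] (0 : ℝ))
  have hU : (U : Filter ℝ) ≤ 𝓝[>] (0 : ℝ) := Ultrafilter.of_le _
  set bad : Finset (Fin n) := Finset.univ.filter fun u => z u ≠ x u with hbad
  have hmem : ∀ u, u ∈ bad ↔ z u ≠ x u := by simp [hbad]
  have hbad0 : ∀ u ∈ bad, x u ≠ 0 := fun u hu =>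
    apply_ne_zero_of_ne hzx ((hmem u).1 hu)
  have hclosed : ∀ C : MultiCircuit n, C.IsMaximalReal A r →
      C.SatClosed A (RMax.ofReal r) x bad := by
    intro C hC i hi t ht
    rw [hmem] at hi ⊢
    exact (isBalanced_of_mem_limSubspace hz hC).apply_termCol_ne hzx (hC.termWt_ne_zero i) hi ht
  obtain ⟨u0, hu0⟩ := Function.ne_iff.1 hne
  -- Closedness is asked for all maximal multi-circuits, because C is chosen only afterwards, from a
  -- point of K.
  obtain ⟨K, ⟨hKne, hKbad, hK⟩, hKmin⟩ := (wellFounded_lt (α := Finset (Fin n))).has_min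
    {K | K.Nonempty ∧ K ⊆ bad ∧ ∀ C : MultiCircuit n, C.IsMaximalReal A r →
      C.SatClosed A (RMax.ofReal r) x K} ⟨bad, ⟨u0, (hmem u0).2 hu0⟩, subset_rfl, hclosed⟩
  have hK0 : ∀ u ∈ K, x u ≠ 0 := fun u hu => hbad0 u (hKbad hu)
  obtain ⟨u, hu⟩ := hKne
  obtain ⟨C, T, x', hbal, hle, he, hmax, hev⟩ := exists_balanced_limit hU hx (hK0 u hu)
  have hC : C.IsMaximalReal A r := hmax r rfl
  have hxC := isBalanced_of_mem_limSubspace hx hC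
  have hmin : ∀ V ⊆ K, V.Nonempty → C.SatClosed A (RMax.ofReal r) x V → V = K := by
    intro V hVK hVne hV
    by_contra hVne'
    exact hKmin V ⟨hVne, hVK.trans hKbad, fun C' hC' => hV.of_isMaximalReal hxC hC'⟩
      (lt_of_le_of_ne hVK hVne')
  have hstep : ∀ v, v ∈ K ∧ x' v = x v → C.succ T v ∈ K ∧ x' (C.succ T v) = x (C.succ T v) := by
    rintro v ⟨hv, hv'⟩
    obtain ⟨i, rfl⟩ := C.next.surjective v
    rw [MultiCircuit.succ_next]
    exact ⟨hK C hC i hv _ (hbal.termVal_eq_of_le hxC hle hv'),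
      hbal.apply_termCol_eq hxC hle hv' (hC.termWt_ne_zero i) (hK0 _ hv)⟩
  obtain ⟨w, hwu, hw⟩ := exists_periodic_mem_fwdOrbit (C.succ T) u
  have horb : ∀ v ∈ fwdOrbit (C.succ T) u, v ∈ K ∧ x' v = x v := fun v hv =>
    fwdOrbit_induction (p := fun v => v ∈ K ∧ x' v = x v) ⟨hu, he⟩ hstep hv
  have horbw : ∀ v ∈ fwdOrbit (C.succ T) w, v ∈ K ∧ x' v = x v := fun v hv =>
    horb v (fwdOrbit_subset hwu hv)
  have hT : ∀ i, C.next i ∈ fwdOrbit (C.succ T) w → T i ≠ C.term i ∧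
      termVal A (RMax.ofReal r) x i (T i) = termVal A (RMax.ofReal r) x i (C.term i) :=
    fun i hi => ⟨(hbal i).1, hbal.termVal_eq_of_le hxC hle (horbw _ hi).2⟩
  -- The length is computed from the unperturbed data but depends only on C, T and w, so it also
  -- applies to the perturbed matrix.
  have hlen : (C.switch T w hw).length = C.length :=
    MultiCircuit.length_switch_eq hxC hw hC.termWt_ne_zero (fun v hv => hK0 v (horbw v hv).1) hT
      (fun i hi t ht => MultiCircuit.eq_of_saturated hdisj hC hxC (hK C hC) hK0 hmin hw
        (fun v hv => (horbw v hv).1) hT hi ht)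
      (fun v hv => (hcover v (hK0 v (horbw v hv).1)).resolve_left
        ((hmem v).1 (hKbad (horbw v hv).1)))
  obtain ⟨delta, ⟨lam', y, hlam', hCmax, hybal, hyu⟩, hgen⟩ :=
    (hev.and (hU (eventually_distinctLengths hzeta))).exists
  obtain ⟨s, rfl⟩ : ∃ s, lam' = RMax.ofReal s := by
    rcases hlam' with ⟨h0, -⟩ | ⟨_, s, -, hs, -⟩
    · exact absurd h0 (RMax.ofReal_ne_zero r)
    · exact ⟨s, hs⟩
  rw [MultiCircuit.isMaximal_ofReal_iff] at hCmax
  -- Finiteness of the perturbed vector at u is carried along T to the cycle, as switching there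
  -- requires.
  have hy0 : ∀ v ∈ fwdOrbit (C.succ T) w, y v ≠ 0 := fun v hv =>
    fwdOrbit_induction (p := fun v => y v ≠ 0) hyu
      (fun v hv => MultiCircuit.IsBalanced.succ_ne_zero hCmax.termWt_ne_zero hv (hybal _).2.2)
      (fwdOrbit_subset hwu hv)
  exact hgen _ _ _ (MultiCircuit.isMaximal_ofReal_iff.2 (MultiCircuit.isMaximalReal_switch hCmax hw
    hy0 fun i _ => (hybal i).2.2)) (MultiCircuit.isMaximal_ofReal_iff.2 hCmax)
    (MultiCircuit.switch_ne (fun i => (hybal i).1) hw) hlen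

end Covers

/-! ### Covering by other eigenspaces: the eigenvalue ε -/

section Bottom

variable {n : ℕ}

theorem RMax.ofReal_pow (r : ℝ) (k : ℕ) : RMax.ofReal r ^ k = RMax.ofReal (k * r) := by
  induction k with
  | zero => simp
  | succ k ih =>
    rw [pow_succ, ih, RMax.ofReal_mul]
    congr 1
    push_cast
    ring

namespace MultiCircuit

/-- The weights with the parameter included are affine functions of it that agree for all small
values, so their slopes agree. -/
theorem IsMaximal.length_eq_of_zero {A : MPMatrix n} {C C' : MultiCircuit n}
    (hC : C.IsMaximal A 0) (hC' : C'.IsMaximal A 0) : C.length = C'.length := by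
  obtain ⟨m, hm⟩ := eventually_atBot.1 ((hC.2 rfl).and (hC'.2 rfl))
  have hlen : ∀ C : MultiCircuit n, C.length ≤ n := fun C =>
    (Finset.card_le_univ _).trans_eq (Fintype.card_fin n)
  have key : ∀ r ≤ m, (C.weight A).toReal + (n - C.length) * r =
      (C'.weight A).toReal + (n - C'.length) * r := by
    intro r hr
    obtain ⟨h1, h2⟩ := hm r hr
    have h := h1.2.symm.trans h2.2
    rw [← RMax.ofReal_toReal (weight_ne_zero_iff.2 h1.1),
      ← RMax.ofReal_toReal (weight_ne_zero_iff.2 h2.1), RMax.ofReal_pow, RMax.ofReal_pow,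
      RMax.ofReal_mul, RMax.ofReal_mul, RMax.ofReal_inj, Nat.cast_sub (hlen C),
      Nat.cast_sub (hlen C')] at h
    exact h
  have h1 := key m le_rfl
  have h2 := key (m - 1) (by linarith)
  have h3 : (C.length : ℝ) = C'.length := by linarith
  exact_mod_cast h3

/-- On the cycle neither selection uses the diagonal, whose value for `ε` could not match a finite
one. So values there do not depend on the parameter, and the number of vertices is unchanged. -/
theorem isMaximal_zero_switch {A : MPMatrix n} {C : MultiCircuit n} {y : MPVec n}
    {T : Fin n → Option (Fin n)} (hC : C.IsMaximal A 0) (hy : C.IsBalancedBy A 0 y T) {w : Fin n}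
    (hw : w ∈ Function.periodicPts (C.succ T)) (hy0 : ∀ v ∈ fwdOrbit (C.succ T) w, y v ≠ 0)
    (hverts : ∀ i, C.next i ∈ fwdOrbit (C.succ T) w → i ∈ C.verts) :
    (C.switch T w hw).IsMaximal A 0 ∧ (C.switch T w hw).length = C.length := by
  obtain ⟨s, hs⟩ := (hC.2 rfl).exists
  have hT : ∀ i, C.next i ∈ fwdOrbit (C.succ T) w → T i ≠ none := by
    intro i hi h
    have h1 := (hy i).2.2
    have h2 := hs.termWt_ne_zero i
    rw [h, termVal_none, zero_mul, term_of_mem (hverts i hi), termVal_some] at h1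
    rw [term_of_mem (hverts i hi)] at h2
    exact mul_ne_zero h2 (hy0 _ hi) h1.symm
  have hval : ∀ (mu : RMax) (i : Fin n) (t : Option (Fin n)), t ≠ none →
      termVal A mu y i t = termVal A 0 y i t := by
    rintro mu i (_ | j) h
    · exact absurd rfl h
    · rfl
  refine ⟨⟨fun r hr => absurd hr.symm (RMax.ofReal_ne_zero r), fun _ => (hC.2 rfl).mono
    fun mu hmu => isMaximalReal_switch hmu hw hy0 fun i hi => ?_⟩, ?_⟩
  · rw [hval _ i _ (hT i hi), (hy i).2.2, hval (RMax.ofReal mu) i (C.term i) fun h =>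
      term_eq_none_iff.1 h (hverts i hi)]
  · rw [length_eq_card, length_eq_card]
    congr 1
    refine Finset.filter_congr fun i _ => ?_
    rw [term_switch]
    split_ifs with hi
    · simp [hT i hi, term_of_mem (hverts i hi)]
    · rfl

end MultiCircuit

theorem eq_zero_of_mem_rmaxBall_zero {rho : ℝ} {mu : RMax} (h : mu ∈ rmaxBall 0 rho) : mu = 0 := by
  rcases h with ⟨-, h⟩ | ⟨r, s, h, -⟩
  · exact h
  · exact absurd h.symm (RMax.ofReal_ne_zero r)

/-- By equality of lengths and genericity, the `ε`-maximal multi-circuit of each perturbed matrix is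
unique, so all coordinates of x come from the same C. -/
theorem isBalanced_of_mem_limSubspace_zero {A : MPMatrix n} {zeta : Matrix (Fin n) (Fin n) ℝ}
    (hzeta : zeta ∈ genericDirections A) {U : Ultrafilter ℝ} (hU : (U : Filter ℝ) ≤ 𝓝[>] (0 : ℝ))
    {x : MPVec n} (hx : x ∈ limSubspace (perturbedSum A 0 zeta)) {C : MultiCircuit n}
    (hC : ∀ᶠ delta in U, C.IsMaximal (perturb A zeta delta) 0) : C.IsBalanced A 0 x := by
  rw [← MultiCircuit.mem_circuitEigenspace_iff]
  refine mem_of_forall_exists_le fun u hu => ?_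
  obtain ⟨C', T, x', hbal, hle, he, -, hev⟩ := exists_balanced_limit hU hx hu
  obtain ⟨delta, ⟨hCd, ⟨lam', _, hlam', hC', -⟩⟩, hgen⟩ :=
    ((hC.and hev).and (hU (eventually_distinctLengths hzeta))).exists
  rw [eq_zero_of_mem_rmaxBall_zero hlam'] at hC'
  have hCC' : C' = C := by
    by_contra hne
    exact hgen _ _ _ hC' hCd hne (hC'.length_eq_of_zero hCd)
  subst hCC'
  exact ⟨x', MultiCircuit.mem_circuitEigenspace_iff.2 hbal.isBalanced, hle, he⟩

/-- A part of a vector of the eigenspace of `ε` that covers whatever is not covered by other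
eigenspaces is the whole vector. -/
theorem eq_of_cover_zero {A : MPMatrix n} {zeta : Matrix (Fin n) (Fin n) ℝ}
    (hzeta : zeta ∈ genericDirections A) {x z : MPVec n}
    (hx : x ∈ limSubspace (perturbedSum A 0 zeta)) (hz : z ∈ limSubspace (perturbedSum A 0 zeta))
    (hzx : z ≤ x)
    (hcover : ∀ u, x u ≠ 0 → z u = x u ∨
      ∃ mu, mu ≠ 0 ∧ ∃ y, IsDoublyAttained A mu y ∧ y ≤ x ∧ y u = x u) : z = x := by
  by_contra hne
  obtain ⟨u, hu⟩ := Function.ne_iff.1 hne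
  have hU : (Ultrafilter.of (𝓝[>] (0 : ℝ)) : Filter ℝ) ≤ 𝓝[>] (0 : ℝ) := Ultrafilter.of_le _
  obtain ⟨C, T, x', hbal, hle, he, -, hev⟩ :=
    exists_balanced_limit hU hx (apply_ne_zero_of_ne hzx hu)
  have hCev := hev.mono fun delta h => by
    obtain ⟨lam', _, hlam', hC, -⟩ := h
    rw [eq_zero_of_mem_rmaxBall_zero hlam'] at hC
    exact hC
  have hxC := isBalanced_of_mem_limSubspace_zero hzeta hU hx hCev
  have hzC := isBalanced_of_mem_limSubspace_zero hzeta hU hz hCev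
  obtain ⟨delta, ⟨lam', y, hlam', hC, hybal, hyu⟩, hgen⟩ :=
    (hev.and (hU (eventually_distinctLengths hzeta))).exists
  obtain rfl := eq_zero_of_mem_rmaxBall_zero hlam'
  obtain ⟨s, hs⟩ := (hC.2 rfl).exists
  have hA' : ∀ i ∈ C.verts, perturb A zeta delta i (C.next i) ≠ 0 := fun i hi =>
    hs.1 (i, C.next i) ⟨hi, rfl⟩
  have hwt : ∀ i ∈ C.verts, termWt A 0 i (C.term i) ≠ 0 := by
    intro i hi
    rw [MultiCircuit.term_of_mem hi]
    exact left_ne_zero_of_mul (hA' i hi)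
  have hstep : ∀ v, C.next.symm v ∈ C.verts → (z v ≠ x v ∧ x' v = x v ∧ y v ≠ 0) →
      (z (C.succ T v) ≠ x (C.succ T v) ∧ x' (C.succ T v) = x (C.succ T v) ∧
        y (C.succ T v) ≠ 0) := by
    rintro v hv ⟨h1, h2, h3⟩
    obtain ⟨i, rfl⟩ := C.next.surjective v
    rw [Equiv.symm_apply_apply] at hv
    rw [MultiCircuit.succ_next]
    refine ⟨hzC.apply_termCol_ne hzx (hwt i hv) h1 (hbal.termVal_eq_of_le hxC hle h2),
      hbal.apply_termCol_eq hxC hle h2 (hwt i hv) (apply_ne_zero_of_ne hzx h1), fun h0 => ?_⟩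
    have h4 := (hybal i).2.2
    rw [termVal, h0, mul_zero, MultiCircuit.term_of_mem hv, termVal_some] at h4
    exact mul_ne_zero (hA' i hv) h3 h4.symm
  -- Following T, the deficit must reach a row outside C; otherwise a cycle would give a second
  -- `ε`-maximal multi-circuit of the same length.
  obtain ⟨v, ⟨hv1, -, -⟩, hv⟩ : ∃ v, (z v ≠ x v ∧ x' v = x v ∧ y v ≠ 0) ∧
      C.next.symm v ∉ C.verts := by
    by_contra! hall
    have horb : ∀ v ∈ fwdOrbit (C.succ T) u, z v ≠ x v ∧ x' v = x v ∧ y v ≠ 0 := fun v hv =>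
      fwdOrbit_induction (p := fun v => z v ≠ x v ∧ x' v = x v ∧ y v ≠ 0) ⟨hu, he, hyu⟩
        (fun v h => hstep v (hall v h) h) hv
    obtain ⟨w, hwu, hw⟩ := exists_periodic_mem_fwdOrbit (C.succ T) u
    have hsw := MultiCircuit.isMaximal_zero_switch hC hybal hw
      (fun v hv => (horb v (fwdOrbit_subset hwu hv)).2.2)
      (fun i hi => by simpa using hall _ (horb _ (fwdOrbit_subset hwu hi)))
    exact hgen _ _ _ hsw.1 hC (MultiCircuit.switch_ne (fun i => (hybal i).1) hw) hsw.2
  obtain ⟨i, rfl⟩ := C.next.surjective v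
  rw [Equiv.symm_apply_apply] at hv
  rw [C.next_eq i hv] at hv1
  have hx0 := apply_ne_zero_of_ne hzx hv1
  -- In a row outside C balance at `ε` makes all terms of x equal to `ε`, so nothing can match the
  -- finite diagonal term of y'.
  obtain ⟨mu, hmu, y', hy', hyx, hyi⟩ := (hcover i hx0).resolve_left hv1
  obtain ⟨t, ht, hmax⟩ := hy'.exists_ne i none
  have h1 := hmax none
  rcases t with _ | j
  · exact ht rfl
  · have h2 := (hxC i).1 (some j)
    rw [MultiCircuit.term_of_notMem hv, termVal_none, zero_mul] at h2
    have h3 := h1.trans ((termVal_some A mu y' i j).le.trans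
      ((mul_le_mul_right (hyx j) (A i j)).trans h2))
    rw [termVal_none, hyi, le_zero_iff] at h3
    exact mul_ne_zero hmu hx0 h3

theorem eq_of_cover {A : MPMatrix n} {lam : RMax}
    (hdisj : ∀ r, lam = RMax.ofReal r → ∀ C : MultiCircuit n, C.IsMaximal A (RMax.ofReal r) →
      ∀ D D' : MultiCircuit n, D.IsCritical (matB A (RMax.ofReal r) C) →
      D'.IsCritical (matB A (RMax.ofReal r) C) → D ≠ D' → Disjoint D.verts D'.verts)
    {x z : MPVec n} (hx : x ∈ algEigenspace A lam) (hz : z ∈ algEigenspace A lam) (hzx : z ≤ x)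
    (hcover : ∀ u, x u ≠ 0 → z u = x u ∨
      ∃ mu, mu ≠ lam ∧ ∃ y ∈ algEigenspace A mu, y ≤ x ∧ y u = x u) : z = x := by
  obtain ⟨zeta, hzeta⟩ := genericDirections_nonempty A
  have hlim : ∀ mu, algEigenspace A mu ≤ limSubspace (perturbedSum A mu zeta) := fun mu =>
    iInf₂_le zeta hzeta
  have hcover' : ∀ u, x u ≠ 0 → z u = x u ∨
      ∃ mu, mu ≠ lam ∧ ∃ y, IsDoublyAttained A mu y ∧ y ≤ x ∧ y u = x u := by
    refine fun u hu => (hcover u hu).imp_right ?_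
    rintro ⟨mu, hmu, y, hy, hyx, hyu⟩
    -- The covering vector is replaced by one limit of balanced vectors attaining u, for which every
    -- row has its maximum twice.
    obtain ⟨C, T, y', hbal, hle, he, -⟩ := exists_balanced_limit
      (Ultrafilter.of_le (𝓝[>] (0 : ℝ))) (hlim mu hy) (hyu ▸ hu)
    exact ⟨mu, hmu, y', hbal.isDoublyAttained, hle.trans hyx, he.trans hyu⟩
  obtain rfl | ⟨r, rfl⟩ := RMax.eq_zero_or_ofReal lam
  · exact eq_of_cover_zero hzeta (hlim _ hx) (hlim _ hz) hzx hcover'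
  · exact eq_of_cover_ofReal
      (fun C hC => hdisj r rfl C (MultiCircuit.isMaximal_ofReal_iff.2 hC)) hzeta (hlim _ hx)
      (hlim _ hz) hzx hcover'

end Bottom

/-! ### Independence of the union of the bases -/

theorem IsMPBasis.notMem_span_diff {n : ℕ} {B : Set (MPVec n)} {U : Submodule RMax (MPVec n)}
    (hB : IsMPBasis B U) {x : MPVec n} (hx : x ∈ B) : x ∉ Submodule.span RMax (B \ {x}) := by
  intro h
  have hspan : Submodule.span RMax (B \ {x}) = U := by
    rw [← hB.1]
    refine le_antisymm (Submodule.span_mono Set.sdiff_subset) (Submodule.span_le.2 fun b hb => ?_)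
    by_cases hbx : b = x
    · exact hbx ▸ h
    · exact Submodule.subset_span ⟨hb, hbx⟩
  exact (hB.2 hspan Set.sdiff_subset hx).2 rfl

theorem mainTheorem1 (n : ℕ) (A : MPMatrix n)
    (basis : RMax → Set (MPVec n))
    (hbasis : ∀ lam ∈ algEigenvalues A, IsMPBasis (basis lam) (algEigenspace A lam))
    (hdisj : ∀ lam : ℝ, RMax.ofReal lam ∈ algEigenvalues A →
      ∀ C : MultiCircuit n, C.IsMaximal A (RMax.ofReal lam) →
        ∀ D D' : MultiCircuit n,
          D.IsCritical (matB A (RMax.ofReal lam) C) →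
          D'.IsCritical (matB A (RMax.ofReal lam) C) →
          D ≠ D' → Disjoint D.verts D'.verts) :
    IsMPBasis (⋃ lam ∈ algEigenvalues A, basis lam)
        (⨆ lam ∈ algEigenvalues A, algEigenspace A lam) ∧
      ∀ x ∈ ⋃ lam ∈ algEigenvalues A, basis lam,
        x ∉ Submodule.span RMax ((⋃ lam ∈ algEigenvalues A, basis lam) \ {x}) := by
  have hindep : ∀ x ∈ ⋃ lam ∈ algEigenvalues A, basis lam,
      x ∉ Submodule.span RMax ((⋃ lam ∈ algEigenvalues A, basis lam) \ {x}) := by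
    intro x hx hspan
    obtain ⟨lam, hlam, hxlam⟩ := Set.mem_iUnion₂.1 hx
    have hmem : ∀ mu ∈ algEigenvalues A, ∀ b ∈ basis mu, b ∈ algEigenspace A mu :=
      fun mu hmu b hb => (hbasis mu hmu).1 ▸ Submodule.subset_span hb
    have hle : Submodule.span RMax ((⋃ lam ∈ algEigenvalues A, basis lam) \ {x}) ≤
        Submodule.span RMax (basis lam \ {x}) ⊔
          ⨆ mu ∈ {mu | mu ∈ algEigenvalues A ∧ mu ≠ lam}, algEigenspace A mu := by
      refine Submodule.span_le.2 ?_
      rintro b ⟨hb, hbx⟩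
      obtain ⟨mu, hmu, hbmu⟩ := Set.mem_iUnion₂.1 hb
      by_cases h : mu = lam
      · exact Submodule.mem_sup_left (Submodule.subset_span ⟨h ▸ hbmu, hbx⟩)
      · refine Submodule.mem_sup_right ?_
        exact (le_iSup₂_of_le (f := fun mu (_ : mu ∈ {mu | mu ∈ algEigenvalues A ∧ mu ≠ lam}) =>
          algEigenspace A mu) mu ⟨hmu, h⟩ le_rfl) (hmem mu hmu b hbmu)
    obtain ⟨z, hz, y, hy, hzy⟩ := Submodule.mem_sup.1 (hle hspan)
    have hzx : z ≤ x := fun u => hzy ▸ le_max_left (z u) (y u)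
    have hyx : y ≤ x := fun u => hzy ▸ le_max_right (z u) (y u)
    have hzW : z ∈ algEigenspace A lam := by
      rw [← (hbasis lam hlam).1]
      exact Submodule.span_mono Set.sdiff_subset hz
    -- Each coordinate of x comes from z or y, and in the latter case from a vector of a single
    -- other eigenspace.
    have hzeq : z = x := by
      refine eq_of_cover (fun r hr => hdisj r (hr ▸ hlam)) (hmem lam hlam x hxlam) hzW hzx
        fun u hu => ?_
      have hmax : max (z u) (y u) = x u := congrFun hzy u
      rcases max_choice (z u) (y u) with h | h
      · exact Or.inl (h.symm.trans hmax)
      · have hyu : y u = x u := h.symm.trans hmax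
        obtain ⟨mu, y1, hy1, hle1, he1⟩ := exists_le_of_mem_iSup hy (hyu ▸ hu)
        obtain ⟨hmu, y2, hy2, hle2, he2⟩ := exists_le_of_mem_iSup hy1 (he1.trans hyu ▸ hu)
        exact Or.inr ⟨mu, hmu.2, y2, hy2, hle2.trans (hle1.trans hyx),
          he2.trans (he1.trans hyu)⟩
    exact (hbasis lam hlam).notMem_span_diff hxlam (hzeq ▸ hz)
  refine ⟨⟨?_, fun S hS hSU x hx => ?_⟩, hindep⟩
  · simp only [Submodule.span_iUnion]
    exact iSup_congr fun lam => iSup_congr fun hlam => (hbasis lam hlam).1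
  · by_contra hxS
    -- A spanning subset S omitting x would put x in the span of the remaining vectors.
    refine hindep x hx (Submodule.span_mono (fun s hs => ⟨hSU hs, fun h => hxS (h ▸ hs)⟩ :
      S ⊆ (⋃ lam ∈ algEigenvalues A, basis lam) \ {x}) ?_)
    rw [show Submodule.span RMax S = _ from hS]
    obtain ⟨lam, hlam, hxlam⟩ := Set.mem_iUnion₂.1 hx
    have : x ∈ algEigenspace A lam := (hbasis lam hlam).1 ▸ Submodule.subset_span hxlam
    exact (le_iSup₂_of_le (f := fun lam (_ : lam ∈ algEigenvalues A) => algEigenspace A lam)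
      lam hlam le_rfl) this
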